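/- For a positive integer $N$ put $\psi(N) = N\prod_{p\mid N}(1+p^{-1})$ (product over the primes dividing $N$), $\varepsilon(N) = \dfrac{24}{\psi(N)}$ and $$\iota(N) = \frac{1}{N}\sum_{M\mid N}\varphi(M)\,\varepsilon(M),$$ where $\varphi$ is Euler's totient function and the sum is over the positive divisors $M$ of $N$. Let $M_{24}$ be the Mathieu group, acting on $24$ points as the automorphism group of the extended binary Golay code, let $M_{23}\subset M_{24}$ be the stabilizer of one of the points, and let $V$ be the $24$-dimensional permutation representation of $M_{24}$ over $\mathbb{Q}$ with the $24$ points as a basis, restricted to $M_{23}$. Let $N\in\{1,2,3,4,5,6,7,8,11,14,15,23\}$ and let $g\in M_{23}$ be an element of order $N$. Then the trace of $g$ on $V$ is $$\operatorname{Tr}(g : V) = \varepsilon(N),$$ and the space of invariants $V^g = \{v\in V : gv = v\}$ has dimension $$\dim V^g = \iota(N).$$ -/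

import Mathlib

/-- The 24 points: the projective line over the field with 23 elements, `none` being the
point at infinity. -/
abbrev GolayPoint : Type := Option (ZMod 23)

/-- The characteristic vector of the translate by `a` of the set of all squares
(zero included) in `ZMod 23`; its coordinate at infinity is `0`. -/
def golayWord (a : ZMod 23) : GolayPoint → ZMod 2
  | none => 0
  | some x => if IsSquare (x - a) then 1 else 0

/-- The extended binary Golay code, as the extended quadratic residue code modulo 23: it is
spanned by the all-ones word and the 23 words `golayWord a`. -/
def golayCode : Submodule (ZMod 2) (GolayPoint → ZMod 2) :=
  Submodule.span (ZMod 2) (insert 1 (Set.range golayWord))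

/-- The Mathieu group `M₂₄`: the group of all permutations of the 24 points that preserve
the extended binary Golay code. -/
def mathieuM24 : Subgroup (Equiv.Perm GolayPoint) where
  carrier := {σ | ∀ c : GolayPoint → ZMod 2, c ∘ σ ∈ golayCode ↔ c ∈ golayCode}
  one_mem' := fun _ => Iff.rfl
  mul_mem' := fun {σ τ} hσ hτ c => (hτ (c ∘ σ)).trans (hσ c)
  inv_mem' := fun {σ} hσ c => by
    have h := hσ (c ∘ (σ⁻¹ : Equiv.Perm GolayPoint))
    have e : (c ∘ (σ⁻¹ : Equiv.Perm GolayPoint)) ∘ σ = c := by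
      funext y
      simp
    rw [e] at h
    exact h.symm

/-- The Mathieu group `M₂₃`: the stabilizer in `M₂₄` of one of the 24 points. -/
abbrev mathieuM23 (x : GolayPoint) : Subgroup mathieuM24 :=
  MulAction.stabilizer mathieuM24 x

/-- The natural 24-dimensional representation of `M₂₃`: the restriction of the permutation
representation of `M₂₄` on the rational vector space with the 24 points as a basis (the space of
finite formal `ℚ`-linear combinations of points). -/
noncomputable abbrev mathieuRep (x : GolayPoint) :
    Representation ℚ (mathieuM23 x) (MonoidAlgebra ℚ GolayPoint) :=
  Representation.ofMulAction ℚ (mathieuM23 x) GolayPoint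

/-- `ψ(N) = N ∏_{p ∣ N} (1 + p⁻¹)`, the product being over the primes dividing `N`. -/
def dedekindPsi (N : ℕ) : ℚ :=
  (N : ℚ) * ∏ p ∈ N.primeFactors, (1 + (p : ℚ)⁻¹)

/-- `ε(N) = 24 / ψ(N)`. -/
def mathieuEpsilon (N : ℕ) : ℚ :=
  24 / dedekindPsi N

/-- `ι(N) = (1 / N) ∑_{M ∣ N} φ(M) ε(M)`, with `φ` Euler's totient function. -/
def mathieuIota (N : ℕ) : ℚ :=
  (∑ M ∈ N.divisors, (Nat.totient M : ℚ) * mathieuEpsilon M) / (N : ℚ)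

/-! The trace of a permutation is its number of fixed points, so the first claim is a count of fixed
points. The code is self-dual, its weights are divisible by 4, and none equals 4. Counting cosets
then gives exactly one octad through any five points (`exists_isOctad`, `IsOctad.eq_of_five`),
whence a non-identity element fixes at most eight points (`eq_one_of_nine_le_card_fixedSet`).

Since |Fix σ| ≡ |Fix σ^p| mod p, this bound settles the orders 5, 7, 11, 23. For order 2,
self-duality makes the fixed set a codeword, hence an octad. For order 3 only the value 3 has to be
excluded (`card_fixedSet_ne_three`). Orders 6, 14, 15 combine the congruences for two powers. For
orders 4 and 8 congruences are too weak: there σ acts on the octad fixed by its involutory power and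
permutes the tetrads, a Steiner system S(3,4,8), which excludes the wrong counts; the value 8 for
order 4 falls to a direct octad argument.

The dimension of the invariants is the average trace over the powers of g. Their orders divide N, so
stay in the list, and φ(M) of them have order M. -/

/-! ### Squares modulo 23 and the generating words -/

/-- Since -1 is a non-residue modulo 23, exactly one of t, -t is a square when t ≠ 0. Self-duality
rests on this. -/
theorem isSquare_add_isSquare_neg (t : ZMod 23) :
    (1 + (if IsSquare t then 1 else 0) + (if IsSquare (-t) then 1 else 0) : ZMod 2) =
      if t = 0 then 1 else 0 := by
  revert t; decide +kernel

theorem golayWord_dotProduct_golayWord (a b : ZMod 23) :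
    ∑ x, golayWord a x * golayWord b x = 0 := by
  revert a b; decide +kernel

theorem sum_golayWord (a : ZMod 23) : ∑ x, golayWord a x = 0 := by
  revert a; decide +kernel

theorem card_support_golayWord (a : ZMod 23) :
    (Finset.univ.filter fun x => golayWord a x ≠ 0).card = 12 := by
  revert a; decide +kernel

/-- The column of the point `x` in the matrix with rows `golayWord t`, as a bit mask. -/
def golayColumn : GolayPoint → ℕ
  | none => 0
  | some x => [8047777, 7706947, 7025287, 5661967, 2935327, 5870654, 3352701, 6705402, 5022197, 1655787, 3311574, 6623148, 4857689, 1326771, 2653542, 5307084, 2225561, 4451122, 513637, 1027274, 2054548, 4109096, 8218192].getD x.val 0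

theorem golayWord_eq_testBit (x : GolayPoint) (t : ZMod 23) :
    golayWord t x = if (golayColumn x).testBit t.val then 1 else 0 := by
  revert t x; decide +kernel

theorem golayColumn_lt (x : GolayPoint) : golayColumn x < 2 ^ 23 := by
  revert x; decide +kernel

/-- The finite check that excludes weight 4: translation puts one of the four points at 0, which
leaves a search over triples, and bit masks make a sum of columns a single xor. -/
theorem golayColumn_xor_ne : ∀ a b : GolayPoint, a ≠ some 0 ∧ b ≠ a ∧ b ≠ some 0 →
    ∀ c, c ≠ a ∧ c ≠ b ∧ c ≠ some 0 →
    golayColumn a ^^^ golayColumn b ^^^ golayColumn c ≠ golayColumn (some 0) := by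
  decide +kernel

theorem golayWord_add (t d : ZMod 23) (x : GolayPoint) :
    golayWord (t + d) x = golayWord t (x.map (· - d)) := by
  cases x with
  | none => rfl
  | some x => simp only [golayWord, Option.map_some, sub_sub, add_comm t d]

theorem exists_sum_four_golayWord_ne_zero_of_some {a b c : GolayPoint} {d : ZMod 23}
    (hab : a ≠ b) (hac : a ≠ c) (hbc : b ≠ c) (had : a ≠ some d) (hbd : b ≠ some d)
    (hcd : c ≠ some d) :
    ∃ t, golayWord t a + golayWord t b + golayWord t c + golayWord t (some d) ≠ 0 := by
  by_contra! h
  have inj : Function.Injective (Option.map (· - d) : GolayPoint → GolayPoint) :=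
    Option.map_injective (sub_left_injective)
  have h0 : Option.map (· - d) (some d) = some 0 := by simp
  refine golayColumn_xor_ne (a.map (· - d)) (b.map (· - d))
    ⟨h0 ▸ inj.ne had, inj.ne hab.symm, h0 ▸ inj.ne hbd⟩ (c.map (· - d))
    ⟨inj.ne hac.symm, inj.ne hbc.symm, h0 ▸ inj.ne hcd⟩ ?_
  apply Nat.eq_of_testBit_eq
  intro i
  by_cases hi : i < 23
  · have h1 := h ((i : ZMod 23) + d)
    simp only [golayWord_add] at h1
    simp only [golayWord_eq_testBit, h0, ZMod.val_natCast, Nat.mod_eq_of_lt hi] at h1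
    simp only [Nat.testBit_xor]
    revert h1
    generalize (golayColumn (a.map (· - d))).testBit i = p
    generalize (golayColumn (b.map (· - d))).testBit i = q
    generalize (golayColumn (c.map (· - d))).testBit i = r
    generalize (golayColumn (some 0)).testBit i = s
    revert p q r s
    decide
  · have h2 : ∀ x, (golayColumn x).testBit i = false := fun x =>
      Nat.testBit_lt_two_pow ((golayColumn_lt x).trans_le (Nat.pow_le_pow_right (by norm_num)
        (by omega)))
    simp [Nat.testBit_xor, h2]

/-- Any four columns of the matrix with rows `golayWord t` have nonzero sum. -/
theorem exists_sum_four_golayWord_ne_zero {a b c d : GolayPoint} (hab : a ≠ b) (hac : a ≠ c)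
    (had : a ≠ d) (hbc : b ≠ c) (hbd : b ≠ d) (hcd : c ≠ d) :
    ∃ t, golayWord t a + golayWord t b + golayWord t c + golayWord t d ≠ 0 := by
  cases d with
  | some d => exact exists_sum_four_golayWord_ne_zero_of_some hab hac hbc had hbd hcd
  | none =>
    obtain ⟨a, rfl⟩ := Option.ne_none_iff_exists'.1 had
    obtain ⟨t, ht⟩ := exists_sum_four_golayWord_ne_zero_of_some hbd.symm hcd.symm hbc had.symm
      hab.symm hac.symm
    exact ⟨t, fun h => ht (by rw [← h]; ring)⟩

/-! ### Self-duality of the code -/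

theorem sum_mul_eq_zero_of_mem_golayCode {c c' : GolayPoint → ZMod 2} (hc : c ∈ golayCode)
    (hc' : c' ∈ golayCode) : ∑ x, c x * c' x = 0 := by
  have h1 : ∀ w ∈ insert (1 : GolayPoint → ZMod 2) (Set.range golayWord),
      ∀ w' ∈ insert (1 : GolayPoint → ZMod 2) (Set.range golayWord), ∑ x, w x * w' x = 0 := by
    rintro w (rfl | ⟨a, rfl⟩) w' (rfl | ⟨b, rfl⟩)
    · decide
    · simpa using sum_golayWord b
    · simpa using sum_golayWord a
    · exact golayWord_dotProduct_golayWord a b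
  induction hc using Submodule.span_induction with
  | zero => simp
  | add u v _ _ hu hv => simp [add_mul, Finset.sum_add_distrib, hu, hv]
  | smul r u _ hu => simp [mul_assoc, ← Finset.mul_sum, hu]
  | mem w hw =>
    induction hc' using Submodule.span_induction with
    | zero => simp
    | add u v _ _ hu hv => simp [mul_add, Finset.sum_add_distrib, hu, hv]
    | smul r u _ hu => simp [mul_left_comm, ← Finset.mul_sum, hu]
    | mem w' hw' => exact h1 w hw w' hw'

theorem one_mem_golayCode : (1 : GolayPoint → ZMod 2) ∈ golayCode :=
  Submodule.subset_span (Set.mem_insert _ _)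

theorem golayWord_mem_golayCode (a : ZMod 23) : golayWord a ∈ golayCode :=
  Submodule.subset_span (Set.mem_insert_of_mem _ ⟨a, rfl⟩)

/-- The extended Golay code is self-dual. -/
theorem mem_golayCode_of_forall_sum_mul_eq_zero {v : GolayPoint → ZMod 2}
    (h : ∀ c ∈ golayCode, ∑ x, v x * c x = 0) : v ∈ golayCode := by
  have h1 : v none = ∑ a : ZMod 23, v (some a) := by
    have := h 1 one_mem_golayCode
    simp only [Pi.one_apply, mul_one, Fintype.sum_option] at this
    exact CharTwo.add_eq_zero.1 this
  have h2 : ∀ x : ZMod 23, ∑ a : ZMod 23, v (some a) * (if IsSquare (a - x) then 1 else 0) = 0 := by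
    intro x
    have := h _ (golayWord_mem_golayCode x)
    simpa [Fintype.sum_option, golayWord] using this
  -- Orthogonality to the generators yields explicit coefficients: in the identity `h4` below, the
  -- terms with a - x vanish by `h2`, and the constant terms sum to v(∞) by `h1`.
  have h3 : v = v none • (1 : GolayPoint → ZMod 2) +
      ∑ a : ZMod 23, v (some a) • golayWord a := by
    funext x
    cases x with
    | none => simp [golayWord]
    | some x =>
      simp only [Pi.add_apply, Pi.smul_apply, Pi.one_apply, smul_eq_mul, mul_one,
        Finset.sum_apply, golayWord]
      have h4 : ∑ a : ZMod 23, v (some a) * (1 + (if IsSquare (x - a) then 1 else 0) +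
          (if IsSquare (-(x - a)) then 1 else 0)) = v (some x) := by
        simp only [isSquare_add_isSquare_neg, sub_eq_zero]
        simp
      rw [← h4]
      simp only [mul_add, mul_one, Finset.sum_add_distrib, neg_sub]
      rw [h2 x, add_zero, h1]
  rw [h3]
  exact Submodule.add_mem _ (Submodule.smul_mem _ _ one_mem_golayCode)
    (Submodule.sum_mem _ fun a _ => Submodule.smul_mem _ _ (golayWord_mem_golayCode a))

/-! ### Golay sets and their sizes -/

/-- The set of points whose characteristic vector is `v`. -/
def wordSupport (v : GolayPoint → ZMod 2) : Finset GolayPoint :=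
  Finset.univ.filter fun x => v x ≠ 0

/-- The characteristic vector of a set of points. -/
def charVec (A : Finset GolayPoint) : GolayPoint → ZMod 2 :=
  fun x => if x ∈ A then 1 else 0

theorem charVec_wordSupport (v : GolayPoint → ZMod 2) : charVec (wordSupport v) = v := by
  funext x
  simp only [charVec, wordSupport, Finset.mem_filter, Finset.mem_univ, true_and]
  generalize v x = r
  revert r; decide

theorem wordSupport_charVec (A : Finset GolayPoint) : wordSupport (charVec A) = A := by
  ext x; simp [wordSupport, charVec]

theorem charVec_symmDiff (A B : Finset GolayPoint) :
    charVec (symmDiff A B) = charVec A + charVec B := by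
  funext x
  simp only [charVec, Pi.add_apply, Finset.mem_symmDiff]
  by_cases hA : x ∈ A <;> by_cases hB : x ∈ B <;> simp [hA, hB]
  decide

theorem sum_charVec_mul_charVec (A B : Finset GolayPoint) :
    ∑ x, charVec A x * charVec B x = ((A ∩ B).card : ZMod 2) := by
  simp [charVec, ← ite_and, ← Finset.mem_inter, Finset.inter_comm A B]

/-- A set of points whose characteristic vector lies in the Golay code. -/
def IsGolaySet (A : Finset GolayPoint) : Prop := charVec A ∈ golayCode

theorem IsGolaySet.symmDiff {A B : Finset GolayPoint} (hA : IsGolaySet A) (hB : IsGolaySet B) :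
    IsGolaySet (symmDiff A B) := by
  rw [IsGolaySet, charVec_symmDiff]; exact Submodule.add_mem _ hA hB

theorem IsGolaySet.even_card_inter {A B : Finset GolayPoint} (hA : IsGolaySet A)
    (hB : IsGolaySet B) : Even (A ∩ B).card := by
  rw [← ZMod.natCast_eq_zero_iff_even, ← sum_charVec_mul_charVec]
  exact sum_mul_eq_zero_of_mem_golayCode hA hB

theorem isGolaySet_of_forall_even {A : Finset GolayPoint}
    (h : ∀ B, IsGolaySet B → Even (A ∩ B).card) : IsGolaySet A := by
  refine mem_golayCode_of_forall_sum_mul_eq_zero fun c hc => ?_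
  rw [← charVec_wordSupport c, sum_charVec_mul_charVec, ZMod.natCast_eq_zero_iff_even]
  exact h _ (by rwa [IsGolaySet, charVec_wordSupport])

theorem card_symmDiff_add (A B : Finset GolayPoint) :
    (symmDiff A B).card + 2 * (A ∩ B).card = A.card + B.card := by
  have h1 := Finset.card_union_add_card_inter A B
  have h2 : (symmDiff A B).card + (A ∩ B).card = (A ∪ B).card := by
    rw [← Finset.card_union_of_disjoint]
    · congr 1; ext x; simp only [Finset.mem_union, Finset.mem_symmDiff, Finset.mem_inter]; tauto
    · rw [Finset.disjoint_left]; intro x; simp only [Finset.mem_symmDiff, Finset.mem_inter]; tauto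
  omega

/-- The generators have weights 24 and 12, and |A △ B| = |A| + |B| - 2|A ∩ B| with |A ∩ B| even by
self-orthogonality. -/
theorem four_dvd_card_wordSupport {c : GolayPoint → ZMod 2} (hc : c ∈ golayCode) :
    4 ∣ (wordSupport c).card := by
  induction hc using Submodule.span_induction with
  | zero => simp [wordSupport]
  | mem w hw =>
    obtain rfl | ⟨a, rfl⟩ := hw
    · simp [wordSupport, Fintype.card_option, ZMod.card]
    · rw [wordSupport, card_support_golayWord]; norm_num
  | add u v hu' hv' hu hv =>
    have hu' : u ∈ golayCode := hu'
    have hv' : v ∈ golayCode := hv'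
    rw [← charVec_wordSupport u] at hu'
    rw [← charVec_wordSupport v] at hv'
    obtain ⟨k, hk⟩ := IsGolaySet.even_card_inter hu' hv'
    have h1 := card_symmDiff_add (wordSupport u) (wordSupport v)
    have h2 : wordSupport (u + v) = symmDiff (wordSupport u) (wordSupport v) := by
      rw [← wordSupport_charVec (symmDiff _ _), charVec_symmDiff, charVec_wordSupport,
        charVec_wordSupport]
    rw [h2]
    omega
  | smul r u _ hu =>
    obtain rfl | rfl : r = 0 ∨ r = 1 := by revert r; decide
    · simp [wordSupport]
    · simpa using hu

theorem IsGolaySet.four_dvd_card {A : Finset GolayPoint} (hA : IsGolaySet A) : 4 ∣ A.card := by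
  simpa [wordSupport_charVec] using four_dvd_card_wordSupport hA

/-- Orthogonality to every `golayWord t` would make four columns sum to zero. -/
theorem IsGolaySet.card_ne_four {A : Finset GolayPoint} (hA : IsGolaySet A) : A.card ≠ 4 := by
  intro h
  obtain ⟨a, B, ha, rfl, hB⟩ := Finset.card_eq_succ.1 h
  obtain ⟨b, c, d, hbc, hbd, hcd, rfl⟩ := Finset.card_eq_three.1 hB
  simp only [Finset.mem_insert, Finset.mem_singleton, not_or] at ha
  obtain ⟨t, ht⟩ := exists_sum_four_golayWord_ne_zero ha.1 ha.2.1 ha.2.2 hbc hbd hcd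
  apply ht
  have := sum_mul_eq_zero_of_mem_golayCode hA (golayWord_mem_golayCode t)
  simp only [charVec, ite_mul, one_mul, zero_mul, Finset.sum_ite_mem, Finset.univ_inter] at this
  rw [Finset.sum_insert (by simp [ha]), Finset.sum_insert (by simp [hbc, hbd]),
    Finset.sum_insert (by simp [hcd]), Finset.sum_singleton] at this
  rw [← this]; ring

theorem IsGolaySet.eight_le_card {A : Finset GolayPoint} (hA : IsGolaySet A) (h : A.Nonempty) :
    8 ≤ A.card := by
  have h1 := hA.four_dvd_card
  have h2 := hA.card_ne_four
  have h3 := h.card_pos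
  omega

/-! ### The Steiner system S(5,8,24) -/

/-- The pairing with the code has kernel inside the code and image inside its dual space, so 24 ≤ 2
dim C. -/
theorem finrank_quotient_golayCode_le :
    Module.finrank (ZMod 2) ((GolayPoint → ZMod 2) ⧸ golayCode) ≤ 12 := by
  let φ : (GolayPoint → ZMod 2) →ₗ[ZMod 2] golayCode →ₗ[ZMod 2] ZMod 2 :=
    LinearMap.mk₂ (ZMod 2) (fun v c => ∑ x, v x * c.1 x)
      (fun v v' c => by simp [add_mul, Finset.sum_add_distrib])
      (fun r v c => by simp [mul_assoc, ← Finset.mul_sum, mul_add])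
      (fun v c c' => by simp [mul_add, Finset.sum_add_distrib])
      (fun r v c => by simp [mul_left_comm, ← Finset.mul_sum, mul_add])
  have hker : LinearMap.ker φ ≤ golayCode := fun v hv =>
    mem_golayCode_of_forall_sum_mul_eq_zero fun c hc => by
      have := LinearMap.congr_fun (LinearMap.mem_ker.1 hv) ⟨c, hc⟩
      simpa [φ] using this
  have h1 := LinearMap.finrank_range_add_finrank_ker φ
  have h2 := Submodule.finrank_mono hker
  have h3 : Module.finrank (ZMod 2) (LinearMap.range φ) ≤ Module.finrank (ZMod 2) golayCode :=
    (Submodule.finrank_le _).trans_eq (Subspace.dual_finrank_eq (K := ZMod 2) (V := golayCode))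
  have h4 := Submodule.finrank_quotient_add_finrank golayCode
  have h5 : Module.finrank (ZMod 2) (GolayPoint → ZMod 2) = 24 := by
    simp [Fintype.card_option, ZMod.card]
  omega

theorem mk_charVec_eq_iff {A B : Finset GolayPoint} :
    (golayCode.mkQ (charVec A) = golayCode.mkQ (charVec B)) ↔ IsGolaySet (symmDiff A B) := by
  rw [Submodule.mkQ_apply, Submodule.mkQ_apply, Submodule.Quotient.eq, IsGolaySet,
    charVec_symmDiff, CharTwo.sub_eq_add]

/-- The octads of the Golay code. -/
structure IsOctad (O : Finset GolayPoint) : Prop where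
  isGolaySet : IsGolaySet O
  card_eq : O.card = 8

/-- The count is 2(24 + 2024) = 2^12, the upper bound for the number of cosets of the code. -/
theorem exists_finset_card_one_or_three {α : Type*} [Fintype α] [DecidableEq α]
    (hP : (Finset.univ : Finset α).card = 24) : ∃ S : Finset (Finset α × Bool),
      (∀ p ∈ S, p.1.card = 1 ∨ p.1.card = 3) ∧ S.card = 4096 := by
  refine ⟨(Finset.powersetCard 1 Finset.univ ∪ Finset.powersetCard 3 Finset.univ) ×ˢ Finset.univ,
    fun p hp => ?_, ?_⟩
  · rw [Finset.mem_product, Finset.mem_union, Finset.mem_powersetCard,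
      Finset.mem_powersetCard] at hp
    exact hp.1.imp And.right And.right
  · rw [Finset.card_product, Finset.card_union_of_disjoint, Finset.card_powersetCard,
      Finset.card_powersetCard, hP]
    · rw [Finset.card_univ, Fintype.card_bool]
      norm_num [Nat.choose]
    · rw [Finset.disjoint_left]
      intro B h1 h3
      rw [Finset.mem_powersetCard] at h1 h3
      omega

theorem exists_isOctad_superset {A : Finset GolayPoint} (hA : A.card = 5) :
    ∃ O, IsOctad O ∧ A ⊆ O := by
  classical
  -- The flag toggles ∞, so unflagged sets have odd size and flagged ones even size.
  let G : Finset GolayPoint × Bool → Finset GolayPoint :=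
    fun p => if p.2 then symmDiff p.1 {none} else p.1
  obtain ⟨S, hS, hScard⟩ := exists_finset_card_one_or_three
    (show (Finset.univ : Finset GolayPoint).card = 24 by
      rw [Finset.card_univ, Fintype.card_option, ZMod.card])
  have : Finite ((GolayPoint → ZMod 2) ⧸ golayCode) := Quotient.finite _
  have := Fintype.ofFinite ((GolayPoint → ZMod 2) ⧸ golayCode)
  have hQ : Fintype.card ((GolayPoint → ZMod 2) ⧸ golayCode) ≤ 4096 := by
    rw [Module.card_eq_pow_finrank (K := ZMod 2), ZMod.card]
    exact (Nat.pow_le_pow_right (by norm_num) finrank_quotient_golayCode_le).trans (by norm_num)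
  let f : Finset GolayPoint × Bool → (GolayPoint → ZMod 2) ⧸ golayCode :=
    fun p => golayCode.mkQ (charVec (G p))
  -- Different flags give a symmetric difference of odd size; equal flags give one of size at most
  -- 6, too small for a nonzero codeword.
  have hinj : Set.InjOn f S := by
    rintro ⟨B, b⟩ hB ⟨B', b'⟩ hB' h
    have h1 : B.card = 1 ∨ B.card = 3 := hS _ hB
    have h2 : B'.card = 1 ∨ B'.card = 3 := hS _ hB'
    have h3 : IsGolaySet (symmDiff (G (B, b)) (G (B', b'))) := mk_charVec_eq_iff.1 h
    have key : b = b' := by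
      have e1 := card_symmDiff_add (G (B, b)) (G (B', b'))
      have e2 := card_symmDiff_add B {none}
      have e3 := card_symmDiff_add B' {none}
      have e4 := h3.four_dvd_card
      simp only [Finset.card_singleton] at e2 e3
      cases b <;> cases b' <;> simp only [G, Bool.false_eq_true, if_true, if_false] at e1 e4 ⊢ <;>
        omega
    subst key
    have h4 : symmDiff (G (B, b)) (G (B', b)) = symmDiff B B' := by
      cases b
      · simp [G]
      · simp [G, symmDiff_symmDiff_symmDiff_comm]
    rw [h4] at h3
    have e1 := card_symmDiff_add B B'
    have h5 : symmDiff B B' = ∅ := by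
      by_contra hne
      have := h3.eight_le_card (Finset.nonempty_iff_ne_empty.2 hne)
      omega
    rw [← Finset.bot_eq_empty, symmDiff_eq_bot] at h5
    rw [h5]
  have himg : S.image f = Finset.univ := by
    apply Finset.eq_univ_of_card
    have h1 := Finset.card_image_of_injOn hinj
    have h2 := Finset.card_le_univ (S.image f)
    omega
  -- Every coset is now represented, in particular that of A. Parity forces the unflagged case; then
  -- |B △ A| ≤ 8, so it equals 8 and B is disjoint from A.
  obtain ⟨⟨B, b⟩, hB, h⟩ := Finset.mem_image.1
    (himg ▸ Finset.mem_univ (golayCode.mkQ (charVec A)) : golayCode.mkQ (charVec A) ∈ S.image f)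
  have h1 : B.card = 1 ∨ B.card = 3 := hS _ hB
  have h3 : IsGolaySet (symmDiff (G (B, b)) A) := mk_charVec_eq_iff.1 h
  have e1 := card_symmDiff_add (G (B, b)) A
  have e2 := card_symmDiff_add B {none}
  have e4 := h3.four_dvd_card
  simp only [Finset.card_singleton] at e2
  cases b
  · simp only [G, Bool.false_eq_true, if_false] at e1 e4 h3
    have hne : (symmDiff B A).Nonempty := by
      rw [Finset.nonempty_iff_ne_empty, ← Finset.bot_eq_empty, Ne, symmDiff_eq_bot]
      rintro rfl
      omega
    have h8 := h3.eight_le_card hne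
    have h0 : (B ∩ A).card = 0 := by omega
    rw [Finset.card_eq_zero] at h0
    refine ⟨symmDiff B A, ⟨h3, by omega⟩, fun x hx => ?_⟩
    rw [Finset.mem_symmDiff]
    refine Or.inr ⟨hx, fun hxB => ?_⟩
    have : x ∈ B ∩ A := Finset.mem_inter.2 ⟨hxB, hx⟩
    simp [h0] at this
  · simp only [G, if_true] at e1 e4
    omega

theorem exists_isOctad {a b c d e : GolayPoint} (h : [a, b, c, d, e].Nodup) :
    ∃ O, IsOctad O ∧ a ∈ O ∧ b ∈ O ∧ c ∈ O ∧ d ∈ O ∧ e ∈ O := by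
  obtain ⟨O, hO, hsub⟩ := exists_isOctad_superset (List.toFinset_card_of_nodup h)
  exact ⟨O, hO, hsub (by simp), hsub (by simp), hsub (by simp), hsub (by simp), hsub (by simp)⟩

/-- Five common points leave a symmetric difference of size at most 6. -/
theorem IsOctad.eq_of_five {O O' : Finset GolayPoint} (hO : IsOctad O) (hO' : IsOctad O')
    {a b c d e : GolayPoint} (h : [a, b, c, d, e].Nodup)
    (hm : ∀ x ∈ [a, b, c, d, e], x ∈ O ∧ x ∈ O') : O = O' := by
  have h1 : 5 ≤ (O ∩ O').card := by
    rw [← show [a, b, c, d, e].toFinset.card = 5 from List.toFinset_card_of_nodup h]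
    exact Finset.card_le_card fun x hx => Finset.mem_inter.2 (hm x (List.mem_toFinset.1 hx))
  have e1 := card_symmDiff_add O O'
  have h2 : symmDiff O O' = ∅ := by
    by_contra hne
    have h8 := (hO.isGolaySet.symmDiff hO'.isGolaySet).eight_le_card
      (Finset.nonempty_iff_ne_empty.2 hne)
    have := hO.card_eq
    have := hO'.card_eq
    omega
  rwa [← Finset.bot_eq_empty, symmDiff_eq_bot] at h2

/-- A finite set of even size that contains three points contains a fourth one. -/
theorem exists_fourth_of_even_card {S : Finset GolayPoint} (hS : Even S.card)
    {a b c : GolayPoint} (h : [a, b, c].Nodup) (ha : a ∈ S) (hb : b ∈ S) (hc : c ∈ S) :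
    ∃ d ∈ S, d ≠ a ∧ d ≠ b ∧ d ≠ c := by
  have h3 : [a, b, c].toFinset.card = 3 := List.toFinset_card_of_nodup h
  have hsub : [a, b, c].toFinset ⊆ S := by
    intro x hx
    simp only [List.mem_toFinset, List.mem_cons, List.not_mem_nil, or_false] at hx
    rcases hx with rfl | rfl | rfl <;> assumption
  have hlt : [a, b, c].toFinset.card < S.card := by
    have := Finset.card_le_card hsub
    obtain ⟨k, hk⟩ := hS
    omega
  obtain ⟨d, hd, hd'⟩ := Finset.exists_mem_notMem_of_card_lt_card hlt
  simp only [List.mem_toFinset, List.mem_cons, List.not_mem_nil, or_false, not_or] at hd'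
  exact ⟨d, hd, hd'⟩

theorem IsOctad.exists_fourth {O O' : Finset GolayPoint} (hO : IsOctad O) (hO' : IsOctad O')
    {a b c : GolayPoint} (h : [a, b, c].Nodup) (ha : a ∈ O) (hb : b ∈ O) (hc : c ∈ O)
    (ha' : a ∈ O') (hb' : b ∈ O') (hc' : c ∈ O') :
    ∃ d, d ∈ O ∧ d ∈ O' ∧ d ≠ a ∧ d ≠ b ∧ d ≠ c := by
  obtain ⟨d, hd, h⟩ := exists_fourth_of_even_card (hO.isGolaySet.even_card_inter hO'.isGolaySet) h
    (Finset.mem_inter.2 ⟨ha, ha'⟩) (Finset.mem_inter.2 ⟨hb, hb'⟩) (Finset.mem_inter.2 ⟨hc, hc'⟩)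
  exact ⟨d, (Finset.mem_inter.1 hd).1, (Finset.mem_inter.1 hd).2, h⟩

/-! ### The action on octads and the bound of eight fixed points -/

theorem IsGolaySet.map {A : Finset GolayPoint} (hA : IsGolaySet A) {σ : Equiv.Perm GolayPoint}
    (hσ : σ ∈ mathieuM24) : IsGolaySet (A.map σ.toEmbedding) := by
  refine (hσ _).1 ?_
  have : charVec (A.map σ.toEmbedding) ∘ σ = charVec A := by
    funext x; simp [charVec]
  rwa [this]

theorem IsOctad.map {O : Finset GolayPoint} (hO : IsOctad O) {σ : Equiv.Perm GolayPoint}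
    (hσ : σ ∈ mathieuM24) : IsOctad (O.map σ.toEmbedding) :=
  ⟨hO.isGolaySet.map hσ, by rw [Finset.card_map, hO.card_eq]⟩

/-- An octad that contains five points together with their images is mapped into itself. -/
theorem IsOctad.apply_mem {O : Finset GolayPoint} (hO : IsOctad O) {σ : Equiv.Perm GolayPoint}
    (hσ : σ ∈ mathieuM24) {a b c d e : GolayPoint} (h : [a, b, c, d, e].Nodup)
    (hm : ∀ x ∈ [a, b, c, d, e], x ∈ O ∧ σ x ∈ O) {x : GolayPoint} (hx : x ∈ O) : σ x ∈ O := by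
  have h1 : O.map σ.toEmbedding = O := by
    refine (hO.map hσ).eq_of_five hO (h.map σ.injective) fun y hy => ?_
    obtain ⟨x, hx, rfl⟩ : ∃ x ∈ [a, b, c, d, e], σ x = y := List.mem_map.1 hy
    exact ⟨Finset.mem_map.2 ⟨x, (hm x hx).1, rfl⟩, (hm x hx).2⟩
  rw [← h1]
  exact Finset.mem_map.2 ⟨x, hx, rfl⟩

theorem exists_five_of_card {S : Finset GolayPoint} (h : 5 ≤ S.card) :
    ∃ a b c d e, [a, b, c, d, e].Nodup ∧ ∀ x ∈ [a, b, c, d, e], x ∈ S := by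
  obtain ⟨T, hT, hcard⟩ := Finset.exists_subset_card_eq h
  match hl : T.toList with
  | [a, b, c, d, e] =>
    refine ⟨a, b, c, d, e, hl ▸ T.nodup_toList, fun x hx => hT ?_⟩
    rwa [← Finset.mem_toList, hl]
  | [] | [_] | [_, _] | [_, _, _] | [_, _, _, _] | _ :: _ :: _ :: _ :: _ :: _ :: _ =>
    have := T.length_toList
    rw [hl, hcard] at this
    simp at this

theorem exists_mem_ne_four {S : Finset GolayPoint} (h : 5 ≤ S.card) (a b c d : GolayPoint) :
    ∃ x ∈ S, x ≠ a ∧ x ≠ b ∧ x ≠ c ∧ x ≠ d := by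
  have h4 : ({a, b, c, d} : Finset GolayPoint).card ≤ 4 := Finset.card_le_four
  obtain ⟨x, hx, hx'⟩ := Finset.exists_mem_notMem_of_card_lt_card (h4.trans_lt h)
  simp only [Finset.mem_insert, Finset.mem_singleton, not_or] at hx'
  exact ⟨x, hx, hx'⟩

/-- The set of fixed points of a permutation. -/
def fixedSet (σ : Equiv.Perm GolayPoint) : Finset GolayPoint :=
  Finset.univ.filter fun x => σ x = x

theorem mem_fixedSet {σ : Equiv.Perm GolayPoint} {x : GolayPoint} :
    x ∈ fixedSet σ ↔ σ x = x := by
  simp [fixedSet]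

section
variable {σ : Equiv.Perm GolayPoint} (hσ : σ ∈ mathieuM24) {O : Finset GolayPoint}
  (hO : IsOctad O)
include hσ hO

/-- The octad O' through a, b, c, x, y is invariant. A moved fourth common point d would bring σ d
as a fifth one, forcing O = O'. -/
theorem IsOctad.exists_fixed_fourth (hst : ∀ z ∈ O, σ z ∈ O) {x y : GolayPoint} (hx : σ x = x)
    (hy : σ y = y) (hxO : x ∉ O) (hyO : y ∉ O) (hxy : x ≠ y) {a b c : GolayPoint}
    (h : [a, b, c].Nodup) (ha : a ∈ O) (hb : b ∈ O) (hc : c ∈ O) (ha' : σ a = a) (hb' : σ b = b)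
    (hc' : σ c = c) :
    ∃ O' d, IsOctad O' ∧ a ∈ O' ∧ b ∈ O' ∧ c ∈ O' ∧ x ∈ O' ∧ y ∈ O' ∧ d ∈ O' ∧ d ∈ O ∧ σ d = d ∧
      d ≠ a ∧ d ≠ b ∧ d ≠ c := by
  have hn : [a, b, c, x, y].Nodup := by
    simp at h ⊢
    grind
  obtain ⟨O', hO', haO, hbO, hcO, hxO', hyO'⟩ := exists_isOctad hn
  obtain ⟨d, hd, hdO', hda, hdb, hdc⟩ := hO.exists_fourth hO' h ha hb hc haO hbO hcO
  have hst' : ∀ z ∈ O', σ z ∈ O' := fun z hz => hO'.apply_mem hσ hn (by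
    simp [*]) hz
  refine ⟨O', d, hO', haO, hbO, hcO, hxO', hyO', hdO', hd, ?_, hda, hdb, hdc⟩
  by_contra hne
  have hinj := σ.injective
  have : O = O' := hO.eq_of_five hO' (a := a) (b := b) (c := c) (d := d) (e := σ d) (by
    simp at h ⊢
    grind) (by simp [*])
  subst this
  exact hxO hxO'

/-- For a moved point y, the octads through p, q, x, y and a third point of O meet O in a fixed
fourth point, so they are invariant and contain σ y. Two of them then coincide and share five points
with O. -/
theorem IsOctad.eq_one_of_subset_fixedSet (hF : ∀ z ∈ O, σ z = z) {x : GolayPoint} (hx : σ x = x)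
    (hxO : x ∉ O) : σ = 1 := by
  ext1 y
  rw [Equiv.Perm.one_apply]
  by_contra hy
  have hinj := σ.injective
  obtain ⟨p, q, r, r₁, r₂, hn, hm⟩ := exists_five_of_card (S := O) (by rw [hO.card_eq]; norm_num)
  simp only [List.mem_cons, List.not_mem_nil, or_false, forall_eq_or_imp, forall_eq] at hm
  obtain ⟨hp, hq, hr, -, -⟩ := hm
  have hn3 : [p, q, r].Nodup := by simp at hn ⊢; grind
  have hyO : y ∉ O := fun h => hy (hF y h)
  have hn1 : [p, q, r, x, y].Nodup := by simp at hn3 ⊢; grind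
  obtain ⟨O₁, hO₁, hp1, hq1, hr1, hx1, hy1⟩ := exists_isOctad hn1
  obtain ⟨s, hs, hs1, hsp, hsq, hsr⟩ := hO.exists_fourth hO₁ hn3 hp hq hr hp1 hq1 hr1
  have hst1 : ∀ z ∈ O₁, σ z ∈ O₁ := fun z hz => hO₁.apply_mem hσ
    (a := p) (b := q) (c := r) (d := s) (e := x) (by simp at hn3 ⊢; grind) (by simp [*]) hz
  obtain ⟨r', hr', hne⟩ := exists_mem_ne_four (S := O) (by rw [hO.card_eq]; norm_num) p q r s
  have hn4 : [p, q, r'].Nodup := by simp at hn3 ⊢; grind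
  have hn2 : [p, q, r', x, y].Nodup := by simp at hn4 ⊢; grind
  obtain ⟨O₂, hO₂, hp2, hq2, hr2, hx2, hy2⟩ := exists_isOctad hn2
  obtain ⟨s', hs', hs2, hsp', hsq', hsr'⟩ := hO.exists_fourth hO₂ hn4 hp hq hr' hp2 hq2 hr2
  have hst2 : ∀ z ∈ O₂, σ z ∈ O₂ := fun z hz => hO₂.apply_mem hσ
    (a := p) (b := q) (c := r') (d := s') (e := x) (by simp at hn4 ⊢; grind) (by simp [*]) hz
  have h12 : O₁ = O₂ := hO₁.eq_of_five hO₂ (a := p) (b := q) (c := x) (d := y) (e := σ y)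
    (by simp at hn4 ⊢; grind) (by simp [*])
  have h1 : O₁ = O := hO₁.eq_of_five hO (a := p) (b := q) (c := r) (d := s) (e := r')
    (by simp at hn3 ⊢; grind) (by subst h12; simp [*])
  exact hxO (h1 ▸ hx1)

omit hO in
/-- A non-identity element of `M₂₄` has at most eight fixed points. -/
theorem eq_one_of_nine_le_card_fixedSet (h9 : 9 ≤ (fixedSet σ).card) : σ = 1 := by
  have hinj := σ.injective
  obtain ⟨a, b, c, e, e', hn, hm⟩ := exists_five_of_card (S := fixedSet σ) (by omega)
  simp only [List.mem_cons, List.not_mem_nil, or_false, forall_eq_or_imp, forall_eq,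
    mem_fixedSet] at hm
  obtain ⟨ha, hb, hc, he, he'⟩ := hm
  obtain ⟨O, hO, haO, hbO, hcO, heO, heO'⟩ := exists_isOctad hn
  have hst : ∀ z ∈ O, σ z ∈ O := fun z hz => hO.apply_mem hσ hn (by simp [*]) hz
  by_cases hF : ∀ z ∈ O, σ z = z
  · obtain ⟨x, hx, hxO⟩ := Finset.exists_mem_notMem_of_card_lt_card
      (show O.card < (fixedSet σ).card by rw [hO.card_eq]; omega)
    exact hO.eq_one_of_subset_fixedSet hσ hF (mem_fixedSet.1 hx) hxO
  exfalso
  push Not at hF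
  obtain ⟨u, hu, huf⟩ := hF
  -- A moved point and its image leave at most six fixed points in O, hence at least three outside.
  -- The rest of the proof produces seven fixed points in O.
  have hmoved : 2 ≤ (O \ fixedSet σ).card := by
    rw [← Finset.card_pair (Ne.symm huf)]
    refine Finset.card_le_card fun z hz => ?_
    simp only [Finset.mem_insert, Finset.mem_singleton] at hz
    rw [Finset.mem_sdiff, mem_fixedSet]
    rcases hz with rfl | rfl
    · exact ⟨hu, huf⟩
    · exact ⟨hst _ hu, fun h => huf (hinj h)⟩
  have hsum : (O \ fixedSet σ).card + (O ∩ fixedSet σ).card = 8 := by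
    rw [← hO.card_eq]; exact Finset.card_sdiff_add_card_inter _ _
  have hcF := Finset.card_sdiff_add_card_inter (fixedSet σ) O
  rw [Finset.inter_comm] at hcF
  obtain ⟨x, hx, y, hy, hxy⟩ := Finset.one_lt_card.1
    (show 1 < (fixedSet σ \ O).card by omega)
  rw [Finset.mem_sdiff, mem_fixedSet] at hx hy
  have T := fun {a b c : GolayPoint} => hO.exists_fixed_fourth hσ hst hx.1 hy.1 hx.2 hy.2 hxy
    (a := a) (b := b) (c := c)
  have key : ∀ {O₁ O₂ : Finset GolayPoint} {a b c : GolayPoint}, IsOctad O₁ → IsOctad O₂ →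
      [a, b, c].Nodup → a ∈ O → b ∈ O → c ∈ O → x ∈ O₁ → y ∈ O₁ → x ∈ O₂ → y ∈ O₂ →
      a ∈ O₁ → a ∈ O₂ → b ∈ O₁ → b ∈ O₂ → c ∈ O₁ → c ∈ O₂ → O₁ = O₂ := by
    intro O₁ O₂ a b c h1 h2 hn _ _ _ _ _ _ _ _ _ _ _ _ _
    exact h1.eq_of_five h2 (a := a) (b := b) (c := c) (d := x) (e := y)
      (by simp at hn ⊢; grind) (by simp [*])
  have key2 : ∀ {O₁ : Finset GolayPoint} {a b c d e : GolayPoint}, IsOctad O₁ → x ∈ O₁ →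
      [a, b, c, d, e].Nodup → a ∈ O → b ∈ O → c ∈ O → d ∈ O → e ∈ O → a ∈ O₁ → b ∈ O₁ → c ∈ O₁ →
      d ∈ O₁ → e ∈ O₁ → False := by
    intro O₁ a b c d e h1 hx1 hn _ _ _ _ _ _ _ _ _ _
    have : O₁ = O := h1.eq_of_five hO hn (by simp [*])
    exact hx.2 (this ▸ hx1)
  simp only [List.nodup_cons, List.mem_cons, List.not_mem_nil, or_false, not_or,
    not_false_eq_true, List.nodup_nil, and_true] at hn key key2 T
  obtain ⟨O₁, d, hO₁, ha1, hb1, hc1, hx1, hy1, hd1, hdO, hd, hda, hdb, hdc⟩ :=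
    T (by grind) haO hbO hcO ha hb hc
  obtain ⟨f, hfO, hf, hfa, hfb, hfc, hfd⟩ : ∃ f ∈ O, σ f = f ∧ f ≠ a ∧ f ≠ b ∧ f ≠ c ∧ f ≠ d := by
    by_cases hde : d = e
    · exact ⟨e', heO', he', by grind⟩
    · exact ⟨e, heO, he, by grind⟩
  -- With a, b, c, d in hand, closing the triples a, b, f and a, c, f gives g and i; a coincidence
  -- would merge two of the octads through x, y.
  have hf1 : f ∉ O₁ := fun h => key2 hO₁ hx1 (a := a) (b := b) (c := c) (d := d) (e := f)
    (by grind) haO hbO hcO hdO hfO ha1 hb1 hc1 hd1 h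
  obtain ⟨O₂, g, hO₂, ha2, hb2, hf2, hx2, hy2, hg2, hgO, hg, hga, hgb, hgf⟩ :=
    T (a := a) (b := b) (c := f) (by grind) haO hbO hfO ha hb hf
  have h12 : O₁ ≠ O₂ := fun h => hf1 (h ▸ hf2)
  have hgc : g ≠ c := fun h => h12 (key hO₁ hO₂ (a := a) (b := b) (c := c) (by grind)
    haO hbO hcO hx1 hy1 hx2 hy2 ha1 ha2 hb1 hb2 hc1 (h ▸ hg2))
  have hgd : g ≠ d := fun h => h12 (key hO₁ hO₂ (a := a) (b := b) (c := d) (by grind)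
    haO hbO hdO hx1 hy1 hx2 hy2 ha1 ha2 hb1 hb2 hd1 (h ▸ hg2))
  obtain ⟨O₃, i, hO₃, ha3, hc3, hf3, hx3, hy3, hi3, hiO, hi, hia, hic, hif⟩ :=
    T (a := a) (b := c) (c := f) (by grind) haO hcO hfO ha hc hf
  have h13 : O₁ ≠ O₃ := fun h => hf1 (h ▸ hf3)
  have hib : i ≠ b := fun h => h13 (key hO₁ hO₃ (a := a) (b := b) (c := c) (by grind)
    haO hbO hcO hx1 hy1 hx3 hy3 ha1 ha3 hb1 (h ▸ hi3) hc1 hc3)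
  have hid : i ≠ d := fun h => h13 (key hO₁ hO₃ (a := a) (b := c) (c := d) (by grind)
    haO hcO hdO hx1 hy1 hx3 hy3 ha1 ha3 hc1 hc3 hd1 (h ▸ hi3))
  have hig : i ≠ g := fun h => by
    have h23 : O₂ = O₃ := key hO₂ hO₃ (a := a) (b := f) (c := g) (by grind)
      haO hfO hgO hx2 hy2 hx3 hy3 ha2 ha3 hf2 hf3 hg2 (h ▸ hi3)
    exact key2 hO₂ hx2 (a := a) (b := b) (c := c) (d := f) (e := g) (by grind)
      haO hbO hcO hfO hgO ha2 hb2 (h23 ▸ hc3) hf2 hg2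
  have h7 : [a, b, c, d, f, g, i].toFinset.card = 7 :=
    List.toFinset_card_of_nodup (by
      simp only [List.nodup_cons, List.mem_cons, List.not_mem_nil, or_false, not_or,
        not_false_eq_true, List.nodup_nil, and_true]
      grind)
  have hsub : [a, b, c, d, f, g, i].toFinset ⊆ O ∩ fixedSet σ := by
    intro z hz
    simp only [List.mem_toFinset, List.mem_cons, List.not_mem_nil, or_false] at hz
    rw [Finset.mem_inter, mem_fixedSet]
    rcases hz with rfl | rfl | rfl | rfl | rfl | rfl | rfl <;> exact ⟨by assumption, by assumption⟩
  have := Finset.card_le_card hsub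
  omega
end

/-! ### Congruences for fixed points; orders other than 4 and 8 -/

theorem card_modEq_card_inter_fixedSet {σ : Equiv.Perm GolayPoint} {S : Finset GolayPoint}
    (hst : ∀ z ∈ S, σ z ∈ S) {p : ℕ} [Fact p.Prime] (hp : ∀ z ∈ S, (σ ^ p) z = z) :
    S.card ≡ (S ∩ fixedSet σ).card [MOD p] := by
  let f : Function.End S := fun z => ⟨σ z, hst z z.2⟩
  have hf : ∀ (k : ℕ) (z : S), ((f ^ k) z : GolayPoint) = (σ ^ k) z := by
    intro k
    induction k with
    | zero => intro z; rfl
    | succ k ih => intro z; rw [pow_succ, pow_succ, Equiv.Perm.mul_apply]; exact ih (f z)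
  have h := Equiv.Perm.card_fixedPoints_modEq (f := f) (p := p) (n := 1) (by
    funext z
    apply Subtype.ext
    rw [pow_one, hf]
    exact hp z z.2)
  rw [Fintype.card_coe] at h
  convert h using 1
  rw [← Fintype.card_coe]
  refine Fintype.card_congr ⟨fun z => ⟨⟨z, (Finset.mem_inter.1 z.2).1⟩, Subtype.ext
    (mem_fixedSet.1 (Finset.mem_inter.1 z.2).2)⟩, fun z => ⟨z, Finset.mem_inter.2 ⟨z.1.2,
    mem_fixedSet.2 (congrArg Subtype.val z.2)⟩⟩, fun _ => rfl, fun _ => rfl⟩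

theorem fixedSet_subset_fixedSet_pow (σ : Equiv.Perm GolayPoint) (k : ℕ) :
    fixedSet σ ⊆ fixedSet (σ ^ k) := fun _ hz =>
  mem_fixedSet.2 (Equiv.Perm.pow_apply_eq_self_of_apply_eq_self (mem_fixedSet.1 hz) k)

theorem apply_mem_fixedSet_pow (σ : Equiv.Perm GolayPoint) (k : ℕ) {z : GolayPoint}
    (hz : z ∈ fixedSet (σ ^ k)) : σ z ∈ fixedSet (σ ^ k) := by
  rw [mem_fixedSet] at hz ⊢
  rw [← Equiv.Perm.mul_apply, ← pow_succ, pow_succ', Equiv.Perm.mul_apply, hz]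

theorem card_fixedSet_pow_modEq (σ : Equiv.Perm GolayPoint) (p : ℕ) [Fact p.Prime] :
    (fixedSet (σ ^ p)).card ≡ (fixedSet σ).card [MOD p] := by
  have h := card_modEq_card_inter_fixedSet (σ := σ) (S := fixedSet (σ ^ p)) (p := p)
    (fun _ => apply_mem_fixedSet_pow σ p) (fun _ => mem_fixedSet.1)
  rwa [Finset.inter_eq_right.2 (fixedSet_subset_fixedSet_pow σ p)] at h

theorem card_fixedSet_one : (fixedSet 1).card = 24 := by
  have : fixedSet 1 = Finset.univ := by ext; simp [mem_fixedSet]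
  rw [this, Finset.card_univ, Fintype.card_option, ZMod.card]

theorem card_fixedSet_le_eight {σ : Equiv.Perm GolayPoint} (hσ : σ ∈ mathieuM24) (h1 : σ ≠ 1) :
    (fixedSet σ).card ≤ 8 := by
  by_contra! h
  exact h1 (eq_one_of_nine_le_card_fixedSet hσ h)

theorem ne_one_of_orderOf {σ : Equiv.Perm GolayPoint} {n : ℕ} (h : orderOf σ = n) (hn : n ≠ 1) :
    σ ≠ 1 := fun h1 => hn (h ▸ h1 ▸ orderOf_one)

theorem card_fixedSet_modEq {σ : Equiv.Perm GolayPoint} {p : ℕ} [Fact p.Prime]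
    (h : orderOf σ = p) : (fixedSet σ).card ≡ 24 [MOD p] := by
  have := card_fixedSet_pow_modEq σ p
  rw [← h, pow_orderOf_eq_one, card_fixedSet_one, h] at this
  exact this.symm

section
variable {σ : Equiv.Perm GolayPoint} (hσ : σ ∈ mathieuM24)
include hσ

/-- For a codeword B, the even set B ∩ σB is σ-invariant with fixed part B ∩ Fix σ, which is
therefore even; self-duality concludes. -/
theorem isGolaySet_fixedSet (h2 : σ ^ 2 = 1) : IsGolaySet (fixedSet σ) := by
  refine isGolaySet_of_forall_even fun B hB => ?_
  have hσσ : ∀ z, σ (σ z) = z := fun z => by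
    rw [← Equiv.Perm.mul_apply, ← sq, h2, Equiv.Perm.one_apply]
  have hmem : ∀ z, z ∈ B ∩ B.map σ.toEmbedding ↔ z ∈ B ∧ σ z ∈ B := by
    intro z
    rw [Finset.mem_inter, Finset.mem_map_equiv, show σ.symm z = σ z from
      σ.symm_apply_eq.2 (hσσ z).symm]
  have h := card_modEq_card_inter_fixedSet (σ := σ) (S := B ∩ B.map σ.toEmbedding) (p := 2)
    (fun z hz => (hmem _).2 ⟨((hmem z).1 hz).2, (hσσ z).symm ▸ ((hmem z).1 hz).1⟩)
    (fun z _ => by rw [h2, Equiv.Perm.one_apply])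
  have h3 : B ∩ B.map σ.toEmbedding ∩ fixedSet σ = fixedSet σ ∩ B := by
    ext z
    rw [Finset.mem_inter, hmem, Finset.mem_inter, mem_fixedSet]
    constructor
    · rintro ⟨h, h'⟩; exact ⟨h', h.1⟩
    · rintro ⟨h, h'⟩; exact ⟨⟨h', h.symm ▸ h'⟩, h⟩
  rw [h3] at h
  have h4 := hB.even_card_inter (hB.map hσ)
  rw [Nat.even_iff] at h4 ⊢
  exact Eq.trans h.symm h4

theorem isOctad_fixedSet {x : GolayPoint} (hx : σ x = x) (h2 : σ ^ 2 = 1) (h1 : σ ≠ 1) :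
    IsOctad (fixedSet σ) :=
  have h := isGolaySet_fixedSet hσ h2
  ⟨h, le_antisymm (card_fixedSet_le_eight hσ h1) (h.eight_le_card ⟨x, mem_fixedSet.2 hx⟩)⟩

/-- The octad through a, b and a 3-cycle is invariant and, modulo 3, has exactly six moved points.
These six-point blocks would partition the 21 moved points. -/
theorem card_fixedSet_ne_three (h3 : σ ^ 3 = 1) : (fixedSet σ).card ≠ 3 := by
  intro hF
  have hinj := σ.injective
  obtain ⟨a, b, c, hab, -, -, hFe⟩ := Finset.card_eq_three.1 hF
  have ha : σ a = a := mem_fixedSet.1 (by simp [hFe])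
  have hb : σ b = b := mem_fixedSet.1 (by simp [hFe])
  have h3' : ∀ z, σ (σ (σ z)) = z := fun z => by
    simpa [pow_succ] using congrArg (fun g : Equiv.Perm GolayPoint => g z) h3
  have hn : ∀ y, y ∉ fixedSet σ → [a, b, y, σ y, σ (σ y)].Nodup := by
    intro y hy
    rw [mem_fixedSet] at hy
    simp only [List.nodup_cons, List.mem_cons, List.not_mem_nil, or_false, not_or,
      not_false_eq_true, List.nodup_nil, and_true]
    have := h3' y
    grind
  have hex : ∀ y, ∃ O, y ∉ fixedSet σ → IsOctad O ∧ a ∈ O ∧ b ∈ O ∧ y ∈ O ∧ σ y ∈ O ∧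
      σ (σ y) ∈ O := by
    intro y
    by_cases hy : y ∈ fixedSet σ
    · exact ⟨∅, fun h => absurd hy h⟩
    · obtain ⟨O, hO⟩ := exists_isOctad (hn y hy)
      exact ⟨O, fun _ => hO⟩
  choose O hO using hex
  have hst : ∀ y, y ∉ fixedSet σ → ∀ z ∈ O y, σ z ∈ O y := by
    intro y hy z hz
    obtain ⟨h, h'⟩ := hO y hy
    exact h.apply_mem hσ (hn y hy) (by simp [*]) hz
  have hcard : ∀ y, y ∉ fixedSet σ → (O y \ fixedSet σ).card = 6 := by
    intro y hy
    have : Fact (Nat.Prime 3) := ⟨Nat.prime_three⟩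
    have h1 := card_modEq_card_inter_fixedSet (p := 3) (hst y hy) (fun z _ => by rw [h3]; rfl)
    have h2 := Finset.card_sdiff_add_card_inter (O y) (fixedSet σ)
    have h4 : (O y ∩ fixedSet σ).card ≤ 3 := hF ▸ Finset.card_le_card Finset.inter_subset_right
    rw [(hO y hy).1.card_eq, Nat.ModEq] at h1
    rw [(hO y hy).1.card_eq] at h2
    omega
  have hfib : ∀ T ∈ (fixedSet σ)ᶜ.image (fun y => O y \ fixedSet σ),
      ((fixedSet σ)ᶜ.filter fun y => O y \ fixedSet σ = T).card = 6 := by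
    intro T hT
    obtain ⟨y, hy, rfl⟩ := Finset.mem_image.1 hT
    rw [Finset.mem_compl] at hy
    rw [← hcard y hy]
    congr 1
    ext z
    rw [Finset.mem_filter, Finset.mem_compl]
    constructor
    · rintro ⟨hz, h⟩
      rw [← h, Finset.mem_sdiff]
      exact ⟨(hO z hz).2.2.2.1, hz⟩
    · intro h
      rw [Finset.mem_sdiff] at h
      refine ⟨h.2, ?_⟩
      obtain ⟨hy0, hya, hyb, -⟩ := hO y hy
      obtain ⟨hz0, hza, hzb, hz1, hz2, hz3⟩ := hO z h.2
      have := hst y hy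
      rw [hz0.eq_of_five hy0 (hn z h.2) (by simp [*])]
  have h1 := Finset.card_eq_sum_card_image (fun y => O y \ fixedSet σ) (fixedSet σ)ᶜ
  rw [Finset.sum_congr rfl hfib, Finset.sum_const, smul_eq_mul, Finset.card_compl, hF,
    Fintype.card_option, ZMod.card] at h1
  omega

omit hσ in
theorem card_fixedSet_pos {x : GolayPoint} (hx : σ x = x) : 0 < (fixedSet σ).card :=
  Finset.card_pos.2 ⟨x, mem_fixedSet.2 hx⟩

theorem card_fixedSet_of_orderOf_two {x : GolayPoint} (hx : σ x = x) (h : orderOf σ = 2) :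
    (fixedSet σ).card = 8 :=
  (isOctad_fixedSet hσ hx (h ▸ pow_orderOf_eq_one σ) (ne_one_of_orderOf h (by norm_num))).card_eq

theorem card_fixedSet_of_orderOf_three {x : GolayPoint} (hx : σ x = x) (h : orderOf σ = 3) :
    (fixedSet σ).card = 6 := by
  have : Fact (Nat.Prime 3) := ⟨Nat.prime_three⟩
  have h1 := card_fixedSet_modEq h
  have h2 := card_fixedSet_le_eight hσ (ne_one_of_orderOf h (by norm_num))
  have h3 := card_fixedSet_pos hx
  have h4 := card_fixedSet_ne_three hσ (h ▸ pow_orderOf_eq_one σ)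
  rw [Nat.ModEq] at h1
  omega

theorem card_fixedSet_of_orderOf_prime {p : ℕ} (hp : p.Prime) (h9 : 5 ≤ p) (h : orderOf σ = p)
    (hp' : 24 % p + p > 8) : (fixedSet σ).card = 24 % p := by
  have : Fact p.Prime := ⟨hp⟩
  have h1 := card_fixedSet_modEq h
  have h2 := card_fixedSet_le_eight hσ (ne_one_of_orderOf h (by omega))
  rw [Nat.ModEq] at h1
  rw [← h1] at hp' ⊢
  have h3 := Nat.mod_add_div (fixedSet σ).card p
  rcases Nat.eq_zero_or_pos ((fixedSet σ).card / p) with h0 | h0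
  · rw [h0] at h3; omega
  · nlinarith

theorem card_fixedSet_of_orderOf_six {x : GolayPoint} (hx : σ x = x) (h : orderOf σ = 6) :
    (fixedSet σ).card = 2 := by
  have : Fact (Nat.Prime 3) := ⟨Nat.prime_three⟩
  have h2 := card_fixedSet_of_orderOf_three (pow_mem hσ 2)
    (Equiv.Perm.pow_apply_eq_self_of_apply_eq_self hx 2) (by norm_num [orderOf_pow, h])
  have h3 := card_fixedSet_of_orderOf_two (pow_mem hσ 3)
    (Equiv.Perm.pow_apply_eq_self_of_apply_eq_self hx 3) (by norm_num [orderOf_pow, h])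
  -- The count is even, congruent to 8 mod 3 and at most 6.
  have e2 := card_fixedSet_pow_modEq σ 2
  have e3 := card_fixedSet_pow_modEq σ 3
  have e4 := Finset.card_le_card (fixedSet_subset_fixedSet_pow σ 2)
  rw [h2, Nat.ModEq] at e2
  rw [h3, Nat.ModEq] at e3
  omega

theorem card_fixedSet_of_orderOf_fourteen {x : GolayPoint} (hx : σ x = x) (h : orderOf σ = 14) :
    (fixedSet σ).card = 1 := by
  have : Fact (Nat.Prime 7) := ⟨by norm_num⟩
  have h2 := card_fixedSet_of_orderOf_prime (pow_mem hσ 2) (p := 7) (by norm_num) (by norm_num)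
    (by norm_num [orderOf_pow, h]) (by norm_num)
  have h7 := card_fixedSet_of_orderOf_two (pow_mem hσ 7)
    (Equiv.Perm.pow_apply_eq_self_of_apply_eq_self hx 7) (by norm_num [orderOf_pow, h])
  have e7 := card_fixedSet_pow_modEq σ 7
  have e4 := Finset.card_le_card (fixedSet_subset_fixedSet_pow σ 2)
  rw [h7, Nat.ModEq] at e7
  omega

theorem card_fixedSet_of_orderOf_fifteen {x : GolayPoint} (hx : σ x = x) (h : orderOf σ = 15) :
    (fixedSet σ).card = 1 := by
  have : Fact (Nat.Prime 5) := ⟨by norm_num⟩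
  have h3 := card_fixedSet_of_orderOf_prime (pow_mem hσ 3) (p := 5) (by norm_num) (by norm_num)
    (by norm_num [orderOf_pow, h]) (by norm_num)
  have h5 := card_fixedSet_of_orderOf_three (pow_mem hσ 5)
    (Equiv.Perm.pow_apply_eq_self_of_apply_eq_self hx 5) (by norm_num [orderOf_pow, h])
  have e5 := card_fixedSet_pow_modEq σ 5
  have e4 := Finset.card_le_card (fixedSet_subset_fixedSet_pow σ 3)
  rw [h5, Nat.ModEq] at e5
  omega
end

/-! ### Tetrads and elements of order 4 and 8 -/

/-- The intersections with the fixed octad of the octads that are invariant under `τ`. -/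
def IsTetrad (τ : Equiv.Perm GolayPoint) (T : Finset GolayPoint) : Prop :=
  ∃ c, IsOctad c ∧ (∀ z ∈ c, τ z ∈ c) ∧ T = c ∩ fixedSet τ

section
variable {τ : Equiv.Perm GolayPoint}

theorem IsTetrad.even_card_inter (h2 : τ ^ 2 = 1) {T T' : Finset GolayPoint}
    (hT : IsTetrad τ T) (hT' : IsTetrad τ T') : Even (T ∩ T').card := by
  obtain ⟨c, hc, hst, rfl⟩ := hT
  obtain ⟨c', hc', hst', rfl⟩ := hT'
  have h := card_modEq_card_inter_fixedSet (σ := τ) (S := c ∩ c') (p := 2)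
    (fun z hz => Finset.mem_inter.2 ⟨hst z (Finset.mem_inter.1 hz).1,
      hst' z (Finset.mem_inter.1 hz).2⟩) (fun z _ => by rw [h2]; rfl)
  have h4 := hc.isGolaySet.even_card_inter hc'.isGolaySet
  rw [← Finset.inter_inter_distrib_right]
  rw [Nat.even_iff] at h4 ⊢
  exact Eq.trans h.symm h4

theorem IsTetrad.exists_ne (h2 : τ ^ 2 = 1) {T T' : Finset GolayPoint}
    (hT : IsTetrad τ T) (hT' : IsTetrad τ T') {a : GolayPoint} (ha : a ∈ T) (ha' : a ∈ T') :
    ∃ d, d ∈ T ∧ d ∈ T' ∧ d ≠ a := by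
  obtain ⟨k, hk⟩ := hT.even_card_inter h2 hT'
  have h1 : 0 < (T ∩ T').card := Finset.card_pos.2 ⟨a, Finset.mem_inter.2 ⟨ha, ha'⟩⟩
  obtain ⟨d, hd, hne⟩ := Finset.exists_mem_ne (show 1 < (T ∩ T').card by omega) a
  exact ⟨d, (Finset.mem_inter.1 hd).1, (Finset.mem_inter.1 hd).2, hne⟩

theorem IsTetrad.exists_fourth (h2 : τ ^ 2 = 1) {T T' : Finset GolayPoint}
    (hT : IsTetrad τ T) (hT' : IsTetrad τ T') {a b c : GolayPoint} (h : [a, b, c].Nodup)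
    (ha : a ∈ T) (hb : b ∈ T) (hc : c ∈ T) (ha' : a ∈ T') (hb' : b ∈ T') (hc' : c ∈ T') :
    ∃ d, d ∈ T ∧ d ∈ T' ∧ d ≠ a ∧ d ≠ b ∧ d ≠ c := by
  obtain ⟨d, hd, hne⟩ := exists_fourth_of_even_card (hT.even_card_inter h2 hT') h
    (Finset.mem_inter.2 ⟨ha, ha'⟩) (Finset.mem_inter.2 ⟨hb, hb'⟩) (Finset.mem_inter.2 ⟨hc, hc'⟩)
  exact ⟨d, (Finset.mem_inter.1 hd).1, (Finset.mem_inter.1 hd).2, hne⟩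

theorem IsTetrad.map {T : Finset GolayPoint} (hT : IsTetrad τ T) {σ : Equiv.Perm GolayPoint}
    (hσ : σ ∈ mathieuM24) (hc : ∀ z, τ (σ z) = σ (τ z)) : IsTetrad τ (T.map σ.toEmbedding) := by
  obtain ⟨c, hcO, hst, rfl⟩ := hT
  refine ⟨c.map σ.toEmbedding, hcO.map hσ, fun z hz => ?_, ?_⟩
  · obtain ⟨y, hy, rfl⟩ := Finset.mem_map.1 hz
    exact Finset.mem_map.2 ⟨τ y, hst y hy, (hc y).symm⟩
  · ext z
    rw [Finset.mem_inter, Finset.mem_map, Finset.mem_map]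
    constructor
    · rintro ⟨y, hy, rfl⟩
      rw [Finset.mem_inter, mem_fixedSet] at hy
      exact ⟨⟨y, hy.1, rfl⟩, mem_fixedSet.2 ((hc y).trans (congrArg σ hy.2))⟩
    · rintro ⟨⟨y, hy, rfl⟩, h⟩
      exact ⟨y, Finset.mem_inter.2 ⟨hy, mem_fixedSet.2 (σ.injective
        ((hc y).symm.trans (mem_fixedSet.1 h)))⟩, rfl⟩

/-- The octad through a, b, c, y, τ y for a moved y is invariant; it meets the fixed octad in a
fourth point, and in no fifth, since it contains y. -/
theorem exists_isTetrad (hτ : τ ∈ mathieuM24) (h2 : τ ^ 2 = 1) (hO : IsOctad (fixedSet τ))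
    {a b c : GolayPoint} (h : [a, b, c].Nodup) (ha : τ a = a) (hb : τ b = b) (hc : τ c = c) :
    ∃ d, τ d = d ∧ d ≠ a ∧ d ≠ b ∧ d ≠ c ∧ IsTetrad τ {a, b, c, d} := by
  have hinj := τ.injective
  obtain ⟨y, hy⟩ : ∃ y, y ∉ fixedSet τ := by
    by_contra! hall
    have := Finset.card_le_card (fun z _ => hall z : Finset.univ ⊆ fixedSet τ)
    rw [hO.card_eq, Finset.card_univ, Fintype.card_option, ZMod.card] at this
    omega
  have hy' := mem_fixedSet.not.1 hy
  have hyy : τ (τ y) = y := by rw [← Equiv.Perm.mul_apply, ← sq, h2, Equiv.Perm.one_apply]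
  have hn : [a, b, c, y, τ y].Nodup := by simp at h ⊢; grind
  obtain ⟨C, hC, haC, hbC, hcC, hyC, hyC'⟩ := exists_isOctad hn
  obtain ⟨d, hd, hdC, hda, hdb, hdc⟩ := hO.exists_fourth hC h (mem_fixedSet.2 ha)
    (mem_fixedSet.2 hb) (mem_fixedSet.2 hc) haC hbC hcC
  refine ⟨d, mem_fixedSet.1 hd, hda, hdb, hdc, C, hC,
    fun z hz => hC.apply_mem hτ hn (by simp [*]) hz, ?_⟩
  ext z
  rw [Finset.mem_inter]
  simp only [Finset.mem_insert, Finset.mem_singleton]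
  constructor
  · rintro (rfl | rfl | rfl | rfl)
    exacts [⟨haC, mem_fixedSet.2 ha⟩, ⟨hbC, mem_fixedSet.2 hb⟩, ⟨hcC, mem_fixedSet.2 hc⟩,
      ⟨hdC, hd⟩]
  · rintro ⟨hzC, hz⟩
    by_contra hne
    have : C = fixedSet τ := hC.eq_of_five hO (a := a) (b := b) (c := c) (d := d) (e := z)
      (by simp at h ⊢; grind) (by
        have := mem_fixedSet.2 ha
        have := mem_fixedSet.2 hb
        have := mem_fixedSet.2 hc
        simp [*])
    exact hy (this ▸ hyC)
end

section
variable {σ : Equiv.Perm GolayPoint} (hσ : σ ∈ mathieuM24)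
include hσ

theorem IsTetrad.map_pow {k : ℕ} {a b c d : GolayPoint} (hT : IsTetrad (σ ^ k) {a, b, c, d}) :
    IsTetrad (σ ^ k) {σ a, σ b, σ c, σ d} := by
  have := hT.map hσ fun z => by
    rw [← Equiv.Perm.mul_apply, ← Equiv.Perm.mul_apply, ← pow_succ, ← pow_succ']
  simpa using this

variable (h4 : σ ^ 4 = 1)
include h4

/-- Here σ swaps u and v. A tetrad {p, q, u, s} with p, q, s fixed would share just three points
with its image, so s = v; but {a, b, u, v} and {a, c, u, v} also share just three. -/
theorem card_fixedSet_ne_six (hO : IsOctad (fixedSet (σ ^ 2))) : (fixedSet σ).card ≠ 6 := by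
  intro h6
  have hinj := σ.injective
  have h2 : (σ ^ 2) ^ 2 = 1 := by rw [← pow_mul, h4]
  have hcard := Finset.card_sdiff_of_subset (fixedSet_subset_fixedSet_pow σ 2)
  rw [h6, hO.card_eq] at hcard
  obtain ⟨u, v, huv, hd⟩ := Finset.card_eq_two.1 hcard
  have hmem : ∀ z, (z = u ∨ z = v) ↔ (σ ^ 2) z = z ∧ σ z ≠ z := by
    intro z
    rw [← mem_fixedSet, Ne, ← mem_fixedSet, ← Finset.mem_sdiff, hd]
    simp
  have hu := (hmem u).1 (Or.inl rfl)
  have hfix : ∀ z, σ z = z → (σ ^ 2) z = z := fun z hz =>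
    Equiv.Perm.pow_apply_eq_self_of_apply_eq_self hz 2
  have huv' : σ u = v := by
    have := (hmem (σ u)).2 ⟨mem_fixedSet.1 (apply_mem_fixedSet_pow σ 2 (mem_fixedSet.2 hu.1)),
      fun h => hu.2 (hinj h)⟩
    tauto
  obtain ⟨a, b, c, _, _, hn, hm⟩ := exists_five_of_card (S := fixedSet σ) (by omega)
  simp only [List.mem_cons, List.not_mem_nil, or_false, forall_eq_or_imp, forall_eq,
    mem_fixedSet] at hm
  obtain ⟨ha, hb, hc, -, -⟩ := hm
  have key : ∀ p q, σ p = p → σ q = q → p ≠ q → IsTetrad (σ ^ 2) {p, q, u, v} := by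
    intro p q hp hq hpq
    obtain ⟨s, hs, hsp, hsq, hsu, hT⟩ := exists_isTetrad (pow_mem hσ 2) h2 hO (a := p) (b := q)
      (c := u) (by simp; grind) (hfix p hp) (hfix q hq) hu.1
    by_cases hsv : s = v
    · rwa [hsv] at hT
    have hs' : σ s = s := by
      by_contra h
      have := (hmem s).2 ⟨hs, h⟩
      tauto
    have hT' := hT.map_pow hσ
    rw [hp, hq, hs', huv'] at hT'
    obtain ⟨d, hd, hd', hne⟩ := hT.exists_fourth h2 hT' (a := p) (b := q) (c := s)
      (by simp; grind) (by simp) (by simp) (by simp) (by simp) (by simp) (by simp)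
    simp only [Finset.mem_insert, Finset.mem_singleton] at hd hd'
    grind
  simp only [List.nodup_cons, List.mem_cons, List.not_mem_nil, or_false, not_or] at hn
  obtain ⟨d, hd, hd', hne⟩ := (key a b ha hb (by tauto)).exists_fourth h2 (key a c ha hc (by tauto))
    (a := a) (b := u) (c := v) (by simp; grind) (by simp) (by simp) (by simp) (by simp) (by simp)
      (by simp)
  simp only [Finset.mem_insert, Finset.mem_singleton] at hd hd'
  grind

/-- On the octad σ fixes a, b and swaps three pairs. Each pair forms a tetrad with a, b. A tetrad
through a and points of two pairs then ends in the third pair, and meets its image only in a, an odd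
intersection. -/
theorem card_fixedSet_ne_two (hO : IsOctad (fixedSet (σ ^ 2))) : (fixedSet σ).card ≠ 2 := by
  intro hF
  have hinj := σ.injective
  have h2 : (σ ^ 2) ^ 2 = 1 := by rw [← pow_mul, h4]
  obtain ⟨a, b, hab, hd⟩ := Finset.card_eq_two.1 hF
  have hmem : ∀ z, (z = a ∨ z = b) ↔ σ z = z := by
    intro z
    rw [← mem_fixedSet, hd]
    simp
  have hfix : ∀ z, σ z = z → (σ ^ 2) z = z := fun z hz =>
    Equiv.Perm.pow_apply_eq_self_of_apply_eq_self hz 2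
  have hsq : ∀ z, (σ ^ 2) z = z ↔ σ (σ z) = z := fun z => by rw [sq, Equiv.Perm.mul_apply]
  have ha := (hmem a).1 (Or.inl rfl)
  have hb := (hmem b).1 (Or.inr rfl)
  have key : ∀ p, (σ ^ 2) p = p → p ≠ a → p ≠ b → IsTetrad (σ ^ 2) {a, p, σ p, b} := by
    intro p hp hpa hpb
    have hpp := (hsq p).1 hp
    have hpm : σ p ≠ p := fun h => by have := (hmem p).2 h; tauto
    obtain ⟨s, hs, hsa, hsp, hsp', hT⟩ := exists_isTetrad (pow_mem hσ 2) h2 hO (a := a) (b := p)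
      (c := σ p) (by simp; grind) (hfix a ha) hp ((hsq _).2 (by rw [hpp]))
    have hT' := hT.map_pow hσ
    rw [ha, hpp] at hT'
    obtain ⟨d, hd, hd', hne⟩ := hT.exists_fourth h2 hT' (a := a) (b := p) (c := σ p)
      (by simp; grind) (by simp) (by simp) (by simp) (by simp) (by simp) (by simp)
    simp only [Finset.mem_insert, Finset.mem_singleton] at hd hd'
    have hss : σ s = s := by grind
    have hsb : s = b := by have := (hmem s).2 hss; tauto
    rwa [hsb] at hT
  obtain ⟨c, hc, hca, hcb, -, -⟩ := exists_mem_ne_four (S := fixedSet (σ ^ 2))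
    (by rw [hO.card_eq]; norm_num) a b a b
  rw [mem_fixedSet] at hc
  have hcc := (hsq c).1 hc
  have hcm : σ c ≠ c := fun h => by have := (hmem c).2 h; tauto
  obtain ⟨e, he, hea, heb, hec, hec'⟩ := exists_mem_ne_four (S := fixedSet (σ ^ 2))
    (by rw [hO.card_eq]; norm_num) a b c (σ c)
  rw [mem_fixedSet] at he
  have hee := (hsq e).1 he
  have hem : σ e ≠ e := fun h => by have := (hmem e).2 h; tauto
  obtain ⟨s, hs, hsa, hsc, hse, hT⟩ := exists_isTetrad (pow_mem hσ 2) h2 hO (a := a) (b := c)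
    (c := e) (by simp; grind) (hfix a ha) hc he
  have hss := (hsq s).1 hs
  have hsb : s ≠ b := by
    rintro rfl
    obtain ⟨d, hd, hd', hne⟩ := hT.exists_fourth h2 (key c hc hca hcb) (a := a) (b := c) (c := s)
      (by simp; grind) (by simp) (by simp) (by simp) (by simp) (by simp) (by simp)
    simp only [Finset.mem_insert, Finset.mem_singleton] at hd hd'
    grind
  have hsc' : s ≠ σ c := by
    rintro rfl
    obtain ⟨d, hd, hd', hne⟩ := hT.exists_fourth h2 (key c hc hca hcb) (a := a) (b := c) (c := σ c)
      (by simp; grind) (by simp) (by simp) (by simp) (by simp) (by simp) (by simp)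
    simp only [Finset.mem_insert, Finset.mem_singleton] at hd hd'
    grind
  have hse' : s ≠ σ e := by
    rintro rfl
    obtain ⟨d, hd, hd', hne⟩ := hT.exists_fourth h2 (key e he hea heb) (a := a) (b := e) (c := σ e)
      (by simp; grind) (by simp) (by simp) (by simp) (by simp) (by simp) (by simp)
    simp only [Finset.mem_insert, Finset.mem_singleton] at hd hd'
    grind
  have hsm : σ s ≠ s := fun h => by have := (hmem s).2 h; tauto
  have hT' := hT.map_pow hσ
  rw [ha] at hT'
  obtain ⟨d, hd, hd', hne⟩ := hT.exists_ne h2 hT' (a := a) (by simp) (by simp)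
  simp only [Finset.mem_insert, Finset.mem_singleton] at hd hd'
  grind

omit h4 in
-- For y outside, the octad through fixed p, q, r and y, σ y is invariant, so contains σ² y. Hence
-- it does not depend on r, and shares five points with the fixed octad.
theorem card_fixedSet_ne_eight (hO : IsOctad (fixedSet (σ ^ 2))) : (fixedSet σ).card ≠ 8 := by
  intro hF
  have hinj := σ.injective
  have hFO : fixedSet σ = fixedSet (σ ^ 2) :=
    Finset.eq_of_subset_of_card_le (fixedSet_subset_fixedSet_pow σ 2) (by rw [hF, hO.card_eq])
  rw [← hFO] at hO
  obtain ⟨y, hy⟩ : ∃ y, y ∉ fixedSet σ := by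
    by_contra! hall
    have := Finset.card_le_card (fun z _ => hall z : Finset.univ ⊆ fixedSet σ)
    rw [hO.card_eq, Finset.card_univ, Fintype.card_option, ZMod.card] at this
    omega
  have hy2 : σ (σ y) ≠ y := fun h => hy (hFO ▸ mem_fixedSet.2 (by
    rw [sq, Equiv.Perm.mul_apply, h]))
  have hy1 := mem_fixedSet.not.1 hy
  obtain ⟨p, q, r, r₁, r₂, hn, hm⟩ := exists_five_of_card (S := fixedSet σ) (by omega)
  simp only [List.mem_cons, List.not_mem_nil, or_false, forall_eq_or_imp, forall_eq] at hm
  obtain ⟨hp, hq, hr, -, -⟩ := hm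
  have hpq : p ≠ q := by simp at hn; tauto
  have hpr : p ≠ r := by simp at hn; tauto
  have hqr : q ≠ r := by simp at hn; tauto
  have key : ∀ r, r ∈ fixedSet σ → r ≠ p → r ≠ q → ∃ C s, IsOctad C ∧ p ∈ C ∧ q ∈ C ∧ r ∈ C ∧
      s ∈ C ∧ s ∈ fixedSet σ ∧ s ≠ p ∧ s ≠ q ∧ s ≠ r ∧ y ∈ C ∧ σ y ∈ C ∧ σ (σ y) ∈ C := by
    intro r hr hrp hrq
    rw [mem_fixedSet] at hp hq hr
    have hn : [p, q, r, y, σ y].Nodup := by simp; grind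
    obtain ⟨C, hC, hpC, hqC, hrC, hyC, hyC'⟩ := exists_isOctad hn
    obtain ⟨s, hs, hsC, hsp, hsq, hsr⟩ := hO.exists_fourth hC (a := p) (b := q) (c := r)
      (by simp; grind) (mem_fixedSet.2 hp) (mem_fixedSet.2 hq) (mem_fixedSet.2 hr) hpC hqC hrC
    have hs' := mem_fixedSet.1 hs
    have hCC : C.map σ.toEmbedding = C := (hC.map hσ).eq_of_five hC (a := p) (b := q) (c := r)
      (d := s) (e := σ y) (by simp; grind) (by
        have hmm : ∀ z ∈ C, σ z ∈ C.map σ.toEmbedding := fun z hz =>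
          Finset.mem_map.2 ⟨z, hz, rfl⟩
        have h1 := hmm p hpC
        have h2 := hmm q hqC
        have h3 := hmm r hrC
        have h4 := hmm s hsC
        have h5 := hmm y hyC
        rw [hp] at h1
        rw [hq] at h2
        rw [hr] at h3
        rw [hs'] at h4
        simp only [List.mem_cons, List.not_mem_nil, or_false, forall_eq_or_imp, forall_eq]
        exact ⟨⟨h1, hpC⟩, ⟨h2, hqC⟩, ⟨h3, hrC⟩, ⟨h4, hsC⟩, ⟨h5, hyC'⟩⟩)
    refine ⟨C, s, hC, hpC, hqC, hrC, hsC, hs, hsp, hsq, hsr, hyC, hyC', ?_⟩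
    rw [← hCC]
    exact Finset.mem_map.2 ⟨σ y, hyC', rfl⟩
  obtain ⟨C, s, hC, hpC, hqC, hrC, hsC, hs, hsp, hsq, hsr, hyC, hyC', hyC''⟩ :=
    key r hr hpr.symm hqr.symm
  obtain ⟨r', hr', hrp, hrq, hrr, hrs⟩ := exists_mem_ne_four (S := fixedSet σ) (by omega) p q r s
  obtain ⟨C', s', hC', hpC1, hqC1, hrC1, -, -, -, -, -, hy0, hy0', hy0''⟩ := key r' hr' hrp hrq
  have hCC : C = C' := hC.eq_of_five hC' (a := p) (b := q) (c := y) (d := σ y) (e := σ (σ y))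
    (by rw [mem_fixedSet] at hp hq; simp; grind) (by simp [*])
  have hCO : C = fixedSet σ := hC.eq_of_five hO (a := p) (b := q) (c := r) (d := s) (e := r')
    (by simp; grind) (by
      subst hCC
      simp only [List.mem_cons, List.not_mem_nil, or_false, forall_eq_or_imp, forall_eq]
      exact ⟨⟨hpC, hp⟩, ⟨hqC, hq⟩, ⟨hrC, hr⟩, ⟨hsC, hs⟩, ⟨hrC1, hr'⟩⟩)
  exact hy (hCO ▸ hyC)
end

section
variable {σ : Equiv.Perm GolayPoint} (hσ : σ ∈ mathieuM24)
include hσ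

theorem card_fixedSet_of_orderOf_four {x : GolayPoint} (hx : σ x = x) (h : orderOf σ = 4) :
    (fixedSet σ).card = 4 := by
  have h4 : σ ^ 4 = 1 := h ▸ pow_orderOf_eq_one σ
  have ho : orderOf (σ ^ 2) = 2 := by norm_num [orderOf_pow, h]
  have hO := isOctad_fixedSet (pow_mem hσ 2)
    (Equiv.Perm.pow_apply_eq_self_of_apply_eq_self hx 2) (by rw [← pow_mul, h4])
    (ne_one_of_orderOf ho (by norm_num))
  have e1 := card_fixedSet_pow_modEq σ 2
  have e2 := Finset.card_le_card (fixedSet_subset_fixedSet_pow σ 2)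
  have e3 := card_fixedSet_pos hx
  have e4 := card_fixedSet_ne_two hσ h4 hO
  have e5 := card_fixedSet_ne_six hσ h4 hO
  have e6 := card_fixedSet_ne_eight hσ hO
  rw [hO.card_eq] at e1 e2
  rw [Nat.ModEq] at e1
  omega

theorem card_fixedSet_of_orderOf_eight {x : GolayPoint} (hx : σ x = x) (h : orderOf σ = 8) :
    (fixedSet σ).card = 2 := by
  have hinj := σ.injective
  have h8 : σ ^ 8 = 1 := h ▸ pow_orderOf_eq_one σ
  have hx4 := Equiv.Perm.pow_apply_eq_self_of_apply_eq_self hx 4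
  have hO := isOctad_fixedSet (pow_mem hσ 4) hx4 (by rw [← pow_mul, h8])
    (ne_one_of_orderOf (n := 2) (by norm_num [orderOf_pow, h]) (by norm_num))
  have h42 := card_fixedSet_of_orderOf_four (pow_mem hσ 2)
    (Equiv.Perm.pow_apply_eq_self_of_apply_eq_self hx 2) (by norm_num [orderOf_pow, h])
  have e1 := card_fixedSet_pow_modEq σ 2
  have e2 := Finset.card_le_card (fixedSet_subset_fixedSet_pow σ 2)
  have e3 := card_fixedSet_pos hx
  rw [h42] at e1 e2
  rw [Nat.ModEq] at e1
  by_contra hne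
  -- In this remaining case σ acts on the octad of σ⁴ with four fixed points and one 4-cycle. A
  -- tetrad through p, q, c must end in σ² c, and two such tetrads share just three points.
  have hF4 : (fixedSet σ).card = 4 := by omega
  have hF : fixedSet σ = fixedSet (σ ^ 2) :=
    Finset.eq_of_subset_of_card_le (fixedSet_subset_fixedSet_pow σ 2) (by omega)
  have h2 : (σ ^ 4) ^ 2 = 1 := by rw [← pow_mul, h8]
  have hfix : ∀ z, σ z = z → (σ ^ 4) z = z := fun z hz =>
    Equiv.Perm.pow_apply_eq_self_of_apply_eq_self hz 4
  have hpow4 : ∀ z, (σ ^ 4) z = σ (σ (σ (σ z))) := fun z => by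
    simp [pow_succ]
  have hsq : ∀ z, σ (σ z) = z → σ z = z := fun z hz => by
    rw [← mem_fixedSet, hF, mem_fixedSet, sq, Equiv.Perm.mul_apply, hz]
  obtain ⟨c, hc, hcF⟩ := Finset.exists_mem_notMem_of_card_lt_card
    (show (fixedSet σ).card < (fixedSet (σ ^ 4)).card by rw [hO.card_eq]; omega)
  rw [mem_fixedSet] at hc hcF
  have hc4 := hpow4 c ▸ hc
  have hmoved : ∀ z, (σ ^ 4) z = z → σ z ≠ z → z = c ∨ z = σ c ∨ z = σ (σ c) ∨
      z = σ (σ (σ c)) := by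
    have hcard : (fixedSet (σ ^ 4) \ fixedSet σ).card = 4 := by
      rw [Finset.card_sdiff_of_subset (fixedSet_subset_fixedSet_pow σ 4), hO.card_eq, hF4]
    have hl : [c, σ c, σ (σ c), σ (σ (σ c))].toFinset.card = 4 := List.toFinset_card_of_nodup (by
      have := hsq c
      simp
      grind)
    have hsub : [c, σ c, σ (σ c), σ (σ (σ c))].toFinset ⊆ fixedSet (σ ^ 4) \ fixedSet σ := by
      intro z hz
      simp only [List.mem_toFinset, List.mem_cons, List.not_mem_nil, or_false] at hz
      rw [Finset.mem_sdiff, mem_fixedSet, mem_fixedSet, hpow4]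
      rcases hz with rfl | rfl | rfl | rfl <;> grind
    have heq := Finset.eq_of_subset_of_card_le hsub (by omega)
    intro z hz hz'
    have : z ∈ fixedSet (σ ^ 4) \ fixedSet σ := by
      rw [Finset.mem_sdiff, mem_fixedSet, mem_fixedSet]; exact ⟨hz, hz'⟩
    rw [← heq] at this
    simpa using this
  have key : ∀ p q, σ p = p → σ q = q → p ≠ q → IsTetrad (σ ^ 4) {p, q, c, σ (σ c)} := by
    intro p q hp hq hpq
    obtain ⟨s, hs, hsp, hsq', hsc, hT⟩ := exists_isTetrad (pow_mem hσ 4) h2 hO (a := p) (b := q)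
      (c := c) (by simp; grind) (hfix p hp) (hfix q hq) hc
    have hcc := hsq c
    have hT' := hT.map_pow hσ
    rw [hp, hq] at hT'
    by_cases hss : σ s = s
    · rw [hss] at hT'
      obtain ⟨d, hd, hd', hne⟩ := hT.exists_fourth h2 hT' (a := p) (b := q) (c := s)
        (by simp; grind) (by simp) (by simp) (by simp) (by simp) (by simp) (by simp)
      simp only [Finset.mem_insert, Finset.mem_singleton] at hd hd'
      grind
    rcases hmoved s hs hss with rfl | rfl | rfl | rfl
    · exact absurd rfl hsc
    · obtain ⟨d, hd, hd', hne⟩ := hT.exists_fourth h2 hT' (a := p) (b := q) (c := σ c)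
        (by simp; grind) (by simp) (by simp) (by simp) (by simp) (by simp) (by simp)
      simp only [Finset.mem_insert, Finset.mem_singleton] at hd hd'
      grind
    · exact hT
    · rw [hc4] at hT'
      obtain ⟨d, hd, hd', hne⟩ := hT.exists_fourth h2 hT' (a := p) (b := q) (c := c)
        (by simp; grind) (by simp) (by simp) (by simp) (by simp) (by simp) (by simp)
      simp only [Finset.mem_insert, Finset.mem_singleton] at hd hd'
      grind
  obtain ⟨p, hpF, q, hqF, r, hrF, hpq, hpr, hqr⟩ := Finset.two_lt_card.1
    (show 2 < (fixedSet σ).card by omega)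
  rw [mem_fixedSet] at hpF hqF hrF
  have hcc := hsq c
  obtain ⟨d, hd, hd', hne⟩ := (key p q hpF hqF hpq).exists_fourth h2 (key p r hpF hrF hpr)
    (a := p) (b := c) (c := σ (σ c)) (by simp; grind) (by simp) (by simp) (by simp) (by simp)
    (by simp) (by simp)
  simp only [Finset.mem_insert, Finset.mem_singleton] at hd hd'
  grind
end

/-! ### Traces and dimensions of invariants -/

theorem trace_mathieuRep (x : GolayPoint) (g : mathieuM23 x) :
    LinearMap.trace ℚ (MonoidAlgebra ℚ GolayPoint) (mathieuRep x g) =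
      ((fixedSet g.1.1).card : ℚ) := by
  let b : Module.Basis GolayPoint ℚ (MonoidAlgebra ℚ GolayPoint) :=
    Module.Basis.ofRepr (MonoidAlgebra.coeffLinearEquiv ℚ)
  have hb : ∀ i, b i = MonoidAlgebra.single i 1 := fun i => rfl
  rw [LinearMap.trace_eq_matrix_trace ℚ b, Matrix.trace, fixedSet, Finset.card_filter]
  push_cast
  refine Finset.sum_congr rfl fun i _ => ?_
  rw [Matrix.diag_apply, LinearMap.toMatrix_apply, hb, Representation.ofMulAction_single]
  have : g • i = g.1.1 i := rfl
  rw [this]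
  simp [b, Finsupp.single_apply]

theorem orderOf_val_val {x : GolayPoint} (g : mathieuM23 x) : orderOf g.1.1 = orderOf g := by
  rw [Subgroup.orderOf_coe, Subgroup.orderOf_coe]

theorem mathieuEpsilon_eq_iff {N : ℕ} {S : Finset ℕ} (hS : N.primeFactors = S) (v : ℚ)
    (h : v * (N * ∏ p ∈ S, (1 + (p : ℚ)⁻¹)) = 24) : v = mathieuEpsilon N := by
  rw [mathieuEpsilon, dedekindPsi, hS, eq_div_iff _, h]
  rintro h0
  rw [h0] at h
  norm_num at h

theorem card_fixedSet_eq_mathieuEpsilon {N : ℕ}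
    (hN : N ∈ ({1, 2, 3, 4, 5, 6, 7, 8, 11, 14, 15, 23} : Finset ℕ))
    {σ : Equiv.Perm GolayPoint} (hσ : σ ∈ mathieuM24) {x : GolayPoint} (hx : σ x = x)
    (h : orderOf σ = N) : ((fixedSet σ).card : ℚ) = mathieuEpsilon N := by
  simp only [Finset.mem_insert, Finset.mem_singleton] at hN
  rcases hN with rfl | rfl | rfl | rfl | rfl | rfl | rfl | rfl | rfl | rfl | rfl | rfl
  · rw [orderOf_eq_one_iff.1 h, card_fixedSet_one]
    exact mathieuEpsilon_eq_iff (S := ∅) (by simp) _ (by norm_num)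
  · rw [card_fixedSet_of_orderOf_two hσ hx h]
    exact mathieuEpsilon_eq_iff (S := {2}) (by decide +kernel) _ (by norm_num)
  · rw [card_fixedSet_of_orderOf_three hσ hx h]
    exact mathieuEpsilon_eq_iff (S := {3}) (by decide +kernel) _ (by norm_num)
  · rw [card_fixedSet_of_orderOf_four hσ hx h]
    exact mathieuEpsilon_eq_iff (S := {2}) (by decide +kernel) _ (by norm_num)
  · rw [card_fixedSet_of_orderOf_prime hσ (by norm_num) (by norm_num) h (by norm_num)]
    exact mathieuEpsilon_eq_iff (S := {5}) (by decide +kernel) _ (by norm_num)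
  · rw [card_fixedSet_of_orderOf_six hσ hx h]
    exact mathieuEpsilon_eq_iff (S := {2, 3}) (by decide +kernel) _ (by norm_num)
  · rw [card_fixedSet_of_orderOf_prime hσ (by norm_num) (by norm_num) h (by norm_num)]
    exact mathieuEpsilon_eq_iff (S := {7}) (by decide +kernel) _ (by norm_num)
  · rw [card_fixedSet_of_orderOf_eight hσ hx h]
    exact mathieuEpsilon_eq_iff (S := {2}) (by decide +kernel) _ (by norm_num)
  · rw [card_fixedSet_of_orderOf_prime hσ (by norm_num) (by norm_num) h (by norm_num)]
    exact mathieuEpsilon_eq_iff (S := {11}) (by decide +kernel) _ (by norm_num)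
  · rw [card_fixedSet_of_orderOf_fourteen hσ hx h]
    exact mathieuEpsilon_eq_iff (S := {2, 7}) (by decide +kernel) _ (by norm_num)
  · rw [card_fixedSet_of_orderOf_fifteen hσ hx h]
    exact mathieuEpsilon_eq_iff (S := {3, 5}) (by decide +kernel) _ (by norm_num)
  · rw [card_fixedSet_of_orderOf_prime hσ (by norm_num) (by norm_num) h (by norm_num)]
    exact mathieuEpsilon_eq_iff (S := {23}) (by decide +kernel) _ (by norm_num)

theorem dvd_mem_orders {N M : ℕ}
    (hN : N ∈ ({1, 2, 3, 4, 5, 6, 7, 8, 11, 14, 15, 23} : Finset ℕ)) (h : M ∣ N) :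
    M ∈ ({1, 2, 3, 4, 5, 6, 7, 8, 11, 14, 15, 23} : Finset ℕ) := by
  have key : ∀ N ∈ ({1, 2, 3, 4, 5, 6, 7, 8, 11, 14, 15, 23} : Finset ℕ), ∀ M < 24, M ∣ N →
    M ∈ ({1, 2, 3, 4, 5, 6, 7, 8, 11, 14, 15, 23} : Finset ℕ) := by decide
  have h24 : ∀ N ∈ ({1, 2, 3, 4, 5, 6, 7, 8, 11, 14, 15, 23} : Finset ℕ), 0 < N ∧ N < 24 := by
    decide
  exact key N hN M ((Nat.le_of_dvd (h24 N hN).1 h).trans_lt (h24 N hN).2) h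

/-- The dimension of the space of vectors fixed by `g` is the average of the character over the
powers of `g`. -/
theorem finrank_eqLocus_eq_sum_trace {G V : Type*} [Group G] [Finite G] [AddCommGroup V]
    [Module ℚ V] [Module.Finite ℚ V] (ρ : Representation ℚ G V) (g : G) :
    (Module.finrank ℚ (LinearMap.eqLocus (ρ g) LinearMap.id) : ℚ) =
      (∑ k ∈ Finset.range (orderOf g), LinearMap.trace ℚ V (ρ (g ^ k))) / orderOf g := by
  have hpos : (orderOf g : ℚ) ≠ 0 := Nat.cast_ne_zero.2 (orderOf_pos g).ne'
  -- Averaging over the powers of g projects onto the invariants, so its trace is their dimension.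
  set A : V →ₗ[ℚ] V := (orderOf g : ℚ)⁻¹ • ∑ k ∈ Finset.range (orderOf g), ρ (g ^ k) with hA
  have hproj : LinearMap.IsProj (LinearMap.eqLocus (ρ g) LinearMap.id) A := by
    constructor
    · intro v
      rw [LinearMap.mem_eqLocus, LinearMap.id_apply, hA, LinearMap.smul_apply, map_smul,
        LinearMap.sum_apply, map_sum]
      congr 1
      have h1 : ∀ k, ρ g (ρ (g ^ k) v) = ρ (g ^ (k + 1)) v := fun k => by
        rw [pow_succ', map_mul, Module.End.mul_apply]
      simp only [h1]
      -- Applying g shifts the sum by one; the terms k = 0 and k = `orderOf g` agree.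
      have h2 := Finset.sum_range_succ (fun k => ρ (g ^ k) v) (orderOf g)
      rw [Finset.sum_range_succ', pow_orderOf_eq_one, pow_zero] at h2
      exact add_right_cancel h2
    · intro v hv
      rw [LinearMap.mem_eqLocus, LinearMap.id_apply] at hv
      have h1 : ∀ k, ρ (g ^ k) v = v := by
        intro k
        induction k with
        | zero => simp
        | succ k ih => rw [pow_succ, map_mul, Module.End.mul_apply, hv, ih]
      rw [hA, LinearMap.smul_apply, LinearMap.sum_apply, Finset.sum_congr rfl fun k _ => h1 k,
        Finset.sum_const, Finset.card_range, ← Nat.cast_smul_eq_nsmul ℚ, smul_smul,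
        inv_mul_cancel₀ hpos, one_smul]
  rw [← hproj.trace, hA, map_smul, map_sum, smul_eq_mul, inv_mul_eq_div]

/-- Exponents are grouped by d = gcd(n, k), where n is the order of g; each class has φ(n/d)
members, whose powers have order n/d. -/
theorem sum_range_orderOf_pow {G : Type*} [Group G] [Finite G] (g : G) (f : ℕ → ℚ) :
    ∑ k ∈ Finset.range (orderOf g), f (orderOf (g ^ k)) =
      ∑ M ∈ (orderOf g).divisors, (Nat.totient M : ℚ) * f M := by
  have hpos := orderOf_pos g
  have h1 : ∀ k ∈ Finset.range (orderOf g),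
      f (orderOf (g ^ k)) = f (orderOf g / Nat.gcd (orderOf g) k) := fun k _ => by
    rw [orderOf_pow]
  rw [Finset.sum_congr rfl h1, ← Nat.sum_div_divisors,
    ← Finset.sum_fiberwise_of_maps_to (t := (orderOf g).divisors)
      (g := fun k => Nat.gcd (orderOf g) k)
      (fun k _ => Nat.mem_divisors.2 ⟨Nat.gcd_dvd_left _ _, hpos.ne'⟩)]
  refine Finset.sum_congr rfl fun d hd => ?_
  rw [Nat.totient_div_of_dvd (Nat.dvd_of_mem_divisors hd), ← nsmul_eq_mul, ← Finset.sum_const]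
  refine Finset.sum_congr rfl fun k hk => ?_
  rw [(Finset.mem_filter.1 hk).2]

theorem mainTheorem11 (N : ℕ)
    (hN : N ∈ ({1, 2, 3, 4, 5, 6, 7, 8, 11, 14, 15, 23} : Finset ℕ))
    (x : GolayPoint) (g : mathieuM23 x) (hg : orderOf g = N) :
    LinearMap.trace ℚ (MonoidAlgebra ℚ GolayPoint) (mathieuRep x g) = mathieuEpsilon N ∧
      (Module.finrank ℚ (LinearMap.eqLocus (mathieuRep x g) LinearMap.id) : ℚ) =
        mathieuIota N := by
  have htrace : ∀ h : mathieuM23 x, orderOf h ∣ N →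
      LinearMap.trace ℚ (MonoidAlgebra ℚ GolayPoint) (mathieuRep x h) =
        mathieuEpsilon (orderOf h) := fun h hdvd => by
    rw [trace_mathieuRep]
    exact card_fixedSet_eq_mathieuEpsilon (dvd_mem_orders hN hdvd) h.1.2 (x := x) h.2
      (orderOf_val_val h)
  refine ⟨hg ▸ htrace g hg.dvd, ?_⟩
  rw [finrank_eqLocus_eq_sum_trace, mathieuIota, hg]
  congr 1
  rw [← hg, ← sum_range_orderOf_pow]
  exact Finset.sum_congr rfl fun k _ => htrace (g ^ k) (hg ▸ orderOf_pow_dvd k)
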